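/- Fix an integer $d\ge 2$. Let $\mathcal G_d$ be the set of isomorphism classes of countable connected rooted simple graphs with all vertex degrees at most $d$. A rooted $(r,d)$-ball is an element of $\mathcal G_d$ all of whose vertices are at distance at most $r$ from the root; let $U^{r,d}$ be the (finite) set of these. For a vertex $x$ of a graph $G$ with degrees at most $d$, let $B_r(x)\in U^{r,d}$ be the subgraph induced on the vertices at distance at most $r$ from $x$, rooted at $x$. For $\alpha\in U^{r,d}$ let $T(\alpha)=T_r(\alpha)\subset\mathcal G_d$ be the set of all $(G,x)$ with $B_r(x)\cong\alpha$. The topology generated by these sets makes $\mathcal G_d$ a compact metrizable space, which carries its Borel $\sigma$-algebra. Let $\vec{\mathcal G}_d$ be the corresponding space of isomorphism classes of countable connected rooted graphs with degrees at most $d$ and with a distinguished directed edge pointing out from the root (isomorphisms preserve the root and the distinguished edge). Its topology is generated by the sets $T(\vec\alpha)=T_r(\vec\alpha)$, $r\ge 1$, where $\vec\alpha$ is an $(r,d)$-ball with a distinguished edge pointing out from its root and $T_r(\vec\alpha)$ consists of the elements of $\vec{\mathcal G}_d$ whose $r$-ball around the root, with the distinguished edge, is isomorphic to $\vec\alpha$.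 A probability measure $\mu$ on $\mathcal G_d$ induces the unique Borel measure $\vec\mu$ on $\vec{\mathcal G}_d$ with $$\vec\mu(T_r(\vec\alpha))=l(\vec\alpha)\,\mu(T_r(\alpha))$$ for all $r\ge1$ and all $\vec\alpha$, where $\alpha$ is the underlying rooted ball of $\vec\alpha$ and $l(\vec\alpha)$ is the number of edges $e$ pointing out from the root of $\alpha$ such that some rooted automorphism of $\alpha$ maps the distinguished edge of $\vec\alpha$ to $e$. The measure $\mu$ is involution-invariant if $\vec\mu$ is invariant under the involution of $\vec{\mathcal G}_d$ that moves the root to the other endpoint of the distinguished edge and reverses that edge. **Theorem.** Let $\mu$ be an involution-invariant Borel probability measure on $\mathcal G_d$ that is concentrated on trees, i.e. $\mu$-almost every element of $\mathcal G_d$ is a tree. Then $\mu$ is the local (Benjamini–Schramm) limit of a convergent sequence of finite graphs with degrees at most $d$: there are finite simple graphs $G_1,G_2,\dots$ (not necessarily connected) with all vertex degrees at most $d$ such that $|V(G_n)|\to\infty$ and, for every $r\ge 0$ and every $\alpha\in U^{r,d}$, $$\lim_{n\to\infty}\frac{|\{x\in V(G_n): B_r(x)\cong\alpha\}|}{|V(G_n)|}=\mu(T_r(\alpha)).$$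 -/

import Mathlib

open MeasureTheory Filter Topology

namespace LocalLimit

/-! ## Balls in a graph -/

/-- The vertex set of the closed ball of radius `r` around `x`. The extended distance is used, so
that vertices outside the connected component of `x` do not belong to the ball. -/
def ballSet {V : Type} (G : SimpleGraph V) (x : V) (r : ℕ) : Set V :=
  {y | G.edist x y ≤ r}

theorem mem_ballSet_self {V : Type} (G : SimpleGraph V) (x : V) (r : ℕ) : x ∈ ballSet G x r := by
  simp [ballSet]

theorem mem_ballSet_of_walk {V : Type} {G : SimpleGraph V} {x y : V} {r : ℕ} (p : G.Walk x y)
    (h : p.length ≤ r) : y ∈ ballSet G x r :=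
  (G.edist_le p).trans (by exact_mod_cast h)

theorem mem_ballSet_iff {V : Type} {G : SimpleGraph V} {x y : V} {r : ℕ} :
    y ∈ ballSet G x r ↔ ∃ p : G.Walk x y, p.length ≤ r := by
  constructor
  · intro h
    have h' : G.edist x y ≤ r := h
    obtain ⟨p, hp⟩ := SimpleGraph.exists_walk_of_edist_ne_top
      (ne_top_of_le_ne_top (ENat.natCast_ne_top r) h')
    exact ⟨p, by rw [← hp] at h'; exact_mod_cast h'⟩
  · rintro ⟨p, hp⟩
    exact mem_ballSet_of_walk p hp

/-- The subgraph induced on a ball is connected. -/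
theorem connected_induce_ballSet {V : Type} (G : SimpleGraph V) (x : V) (r : ℕ) :
    (G.induce (ballSet G x r)).Connected := by
  rw [SimpleGraph.connected_iff_exists_forall_reachable]
  refine ⟨⟨x, mem_ballSet_self G x r⟩, ?_⟩
  rintro ⟨y, hy⟩
  obtain ⟨p, hp⟩ := mem_ballSet_iff.1 hy
  have hs : ∀ z ∈ p.support, z ∈ ballSet G x r := by
    classical
    intro z hz
    exact mem_ballSet_of_walk (p.takeUntil z hz) ((p.length_takeUntil_le_length hz).trans hp)
  exact ⟨p.induce _ hs⟩

/-- `G` has all its vertex degrees at most `d`. -/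
def DegLE {V : Type} (G : SimpleGraph V) (d : ℕ) : Prop :=
  ∀ v, (G.neighborSet v).encard ≤ d

theorem DegLE.induce {V : Type} {G : SimpleGraph V} {d : ℕ} (h : DegLE G d) (s : Set V) :
    DegLE (G.induce s) d := by
  intro v
  refine le_trans ?_ (h v)
  rw [← Subtype.val_injective.encard_image]
  refine Set.encard_le_encard ?_
  rintro _ ⟨w, hw, rfl⟩
  exact hw

theorem map_mem_ballSet {V W : Type} {G : SimpleGraph V} {H : SimpleGraph W} (f : G ≃g H)
    {x y : V} {r : ℕ} : f y ∈ ballSet H (f x) r ↔ y ∈ ballSet G x r := by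
  rw [mem_ballSet_iff, mem_ballSet_iff]
  constructor
  · rintro ⟨p, hp⟩
    exact ⟨(p.map f.symm.toHom).copy (f.symm_apply_apply x) (f.symm_apply_apply y),
      by simpa using hp⟩
  · rintro ⟨p, hp⟩
    exact ⟨p.map f.toHom, by simpa using hp⟩

/-- An isomorphism of graphs restricts to an isomorphism of balls. -/
def ballIso {V W : Type} {G : SimpleGraph V} {H : SimpleGraph W} (f : G ≃g H) (x : V) (x' : W)
    (hx : f x = x') (r : ℕ) :
    G.induce (ballSet G x r) ≃g H.induce (ballSet H x' r) where
  toEquiv := f.toEquiv.subtypeEquiv fun y => by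
    subst hx
    exact (map_mem_ballSet f).symm
  map_rel_iff' := f.map_rel_iff

/-! ## The space of rooted graphs -/

/-- Countable connected rooted simple graphs with all degrees at most `d`. -/
structure RootedGraph (d : ℕ) : Type 1 where
  V : Type
  countable : Countable V
  graph : SimpleGraph V
  connected : graph.Connected
  deg_le : DegLE graph d
  root : V

namespace RootedGraph

variable {d : ℕ}

/-- Rooted isomorphism. -/
def IsIso (G H : RootedGraph d) : Prop :=
  ∃ f : G.graph ≃g H.graph, f G.root = H.root

instance setoid (d : ℕ) : Setoid (RootedGraph d) where
  r := IsIso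
  iseqv :=
    { refl := fun _ => ⟨SimpleGraph.Iso.refl, rfl⟩
      symm := fun ⟨f, hf⟩ => ⟨f.symm, by rw [← hf]; exact f.symm_apply_apply _⟩
      trans := fun ⟨f, hf⟩ ⟨g, hg⟩ => ⟨f.trans g, by rw [← hg, ← hf]; rfl⟩ }

/-- The ball of radius `r` around a vertex `x` of an arbitrary (not necessarily connected)
countable graph, as a rooted graph. -/
def ballAt {V : Type} [hV : Countable V] (G : SimpleGraph V) (hG : DegLE G d) (x : V) (r : ℕ) :
    RootedGraph d where
  V := ballSet G x r
  countable := inferInstance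
  graph := G.induce (ballSet G x r)
  connected := connected_induce_ballSet G x r
  deg_le := hG.induce _
  root := ⟨x, mem_ballSet_self G x r⟩

/-- The ball of radius `r` around the root. -/
def ball (r : ℕ) (G : RootedGraph d) : RootedGraph d :=
  ballAt (hV := G.countable) G.graph G.deg_le G.root r

theorem ball_isIso (r : ℕ) {G H : RootedGraph d} (h : G.IsIso H) :
    (G.ball r).IsIso (H.ball r) := by
  obtain ⟨f, hf⟩ := h
  exact ⟨ballIso f _ _ hf r, Subtype.ext hf⟩

/-- All vertices are within distance `r` of the root: the graph is a rooted `(r, d)`-ball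
(it is then automatically finite). -/
def IsBall (r : ℕ) (G : RootedGraph d) : Prop :=
  ∀ y, G.graph.edist G.root y ≤ r

end RootedGraph

/-- The space of isomorphism classes of countable connected rooted graphs with degrees
at most `d`. -/
def Grd (d : ℕ) : Type 1 := Quotient (RootedGraph.setoid d)

namespace Grd

variable {d : ℕ}

/-- The isomorphism class of a rooted graph. -/
def mk (G : RootedGraph d) : Grd d := Quotient.mk _ G

/-- The isomorphism class of the ball of radius `r` around the root. -/
def ball (r : ℕ) : Grd d → Grd d :=
  Quotient.map (RootedGraph.ball r) fun _ _ h => RootedGraph.ball_isIso r h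

/-- The set of (isomorphism classes of) rooted `(r, d)`-balls. -/
def balls (d r : ℕ) : Set (Grd d) := {α | ∃ A : RootedGraph d, A.IsBall r ∧ mk A = α}

/-- The set of all rooted graphs whose `r`-ball around the root is `α`. -/
def cyl (r : ℕ) (α : Grd d) : Set (Grd d) := {G | ball r G = α}

/-- The topology generated by the sets `cyl r α`: these are the balls of the metric
`2 ^ (- r)`, where `r` is the largest radius for which the balls around the roots agree. -/
instance : TopologicalSpace (Grd d) :=
  TopologicalSpace.generateFrom {S | ∃ r, ∃ α ∈ balls d r, S = cyl r α}

instance : MeasurableSpace (Grd d) := borel _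

instance : BorelSpace (Grd d) := ⟨rfl⟩

/-- The rooted graph is a tree. -/
def IsTree : Grd d → Prop :=
  Quotient.lift (fun G : RootedGraph d => G.graph.IsTree) fun _ _ ⟨f, _⟩ =>
    propext f.isTree_iff

end Grd

/-! ## The space of rooted graphs with a distinguished directed edge -/

/-- Countable connected rooted graphs with degrees at most `d` and with a distinguished directed
edge pointing out from the root, to the vertex `head`. -/
structure EdgeRootedGraph (d : ℕ) : Type 1 extends RootedGraph d where
  head : V
  adj : graph.Adj root head

namespace EdgeRootedGraph

variable {d : ℕ}

/-- Rooted isomorphism that respects the distinguished edge. -/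
def IsIso (G H : EdgeRootedGraph d) : Prop :=
  ∃ f : G.graph ≃g H.graph, f G.root = H.root ∧ f G.head = H.head

instance setoid (d : ℕ) : Setoid (EdgeRootedGraph d) where
  r := IsIso
  iseqv :=
    { refl := fun _ => ⟨SimpleGraph.Iso.refl, rfl, rfl⟩
      symm := fun ⟨f, hf, hf'⟩ => ⟨f.symm, by rw [← hf]; exact f.symm_apply_apply _,
        by rw [← hf']; exact f.symm_apply_apply _⟩
      trans := fun ⟨f, hf, hf'⟩ ⟨g, hg, hg'⟩ =>
        ⟨f.trans g, by rw [← hg, ← hf]; rfl, by rw [← hg', ← hf']; rfl⟩ }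

theorem head_mem_ballSet (G : EdgeRootedGraph d) {r : ℕ} (hr : 1 ≤ r) :
    G.head ∈ ballSet G.graph G.root r :=
  mem_ballSet_of_walk G.adj.toWalk (by simpa using hr)

/-- The ball of radius `r ≥ 1` around the root, with the same distinguished edge. -/
def ball (r : ℕ) (hr : 1 ≤ r) (G : EdgeRootedGraph d) : EdgeRootedGraph d where
  toRootedGraph := G.toRootedGraph.ball r
  head := ⟨G.head, G.head_mem_ballSet hr⟩
  adj := G.adj

theorem ball_isIso (r : ℕ) (hr : 1 ≤ r) {G H : EdgeRootedGraph d} (h : G.IsIso H) :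
    (G.ball r hr).IsIso (H.ball r hr) := by
  obtain ⟨f, hf, hf'⟩ := h
  exact ⟨ballIso f _ _ hf r, Subtype.ext hf, Subtype.ext hf'⟩

/-- Move the root to the other endpoint of the distinguished edge and reverse that edge. -/
def flip (G : EdgeRootedGraph d) : EdgeRootedGraph d where
  toRootedGraph := { G.toRootedGraph with root := G.head }
  head := G.root
  adj := G.adj.symm

/-- The number of edges pointing out from the root to which the distinguished edge can be moved
by a rooted automorphism. -/
noncomputable def multiplicity (G : EdgeRootedGraph d) : ℕ :=
  {y | G.graph.Adj G.root y ∧ ∃ f : G.graph ≃g G.graph, f G.root = G.root ∧ f G.head = y}.ncard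

end EdgeRootedGraph

/-- The space of isomorphism classes of countable connected rooted graphs with degrees at most `d`
and with a distinguished directed edge pointing out from the root. -/
def EdgeGrd (d : ℕ) : Type 1 := Quotient (EdgeRootedGraph.setoid d)

namespace EdgeGrd

variable {d : ℕ}

/-- The isomorphism class of a rooted graph with a distinguished edge. -/
def mk (G : EdgeRootedGraph d) : EdgeGrd d := Quotient.mk _ G

/-- The isomorphism class of the ball of radius `r ≥ 1` around the root. -/
def ball (r : ℕ) (hr : 1 ≤ r) : EdgeGrd d → EdgeGrd d :=
  Quotient.map (EdgeRootedGraph.ball r hr) fun _ _ h => EdgeRootedGraph.ball_isIso r hr h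

/-- The set of all rooted graphs with a distinguished edge whose `r`-ball around the root
(with the distinguished edge) is `α`. -/
def cyl (r : ℕ) (hr : 1 ≤ r) (α : EdgeGrd d) : Set (EdgeGrd d) := {G | ball r hr G = α}

instance : TopologicalSpace (EdgeGrd d) :=
  TopologicalSpace.generateFrom {S | ∃ (r : ℕ) (hr : 1 ≤ r) (A : EdgeRootedGraph d),
    A.toRootedGraph.IsBall r ∧ S = cyl r hr (mk A)}

instance : MeasurableSpace (EdgeGrd d) := borel _

instance : BorelSpace (EdgeGrd d) := ⟨rfl⟩

/-- The involution that moves the root along the distinguished edge and reverses that edge. -/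
def flip : EdgeGrd d → EdgeGrd d :=
  Quotient.map EdgeRootedGraph.flip fun _ _ ⟨f, hf, hf'⟩ => ⟨f, hf', hf⟩

end EdgeGrd

/-! ## Involution invariance -/

/-- `ν` is the measure induced by `μ` on the space of rooted graphs with a distinguished edge:
for every `(r, d)`-ball `A` with a distinguished edge, `r ≥ 1`, the cylinder set of `A` has measure
`l * μ (cylinder set of the underlying rooted ball of A)`, where `l` is the number of edges at
the root equivalent to the distinguished one. As these cylinder sets, with the empty set, form
a countable `π`-system which generates the Borel sets, there is at most one such `ν`. -/
def IsInducedEdgeMeasure {d : ℕ} (μ : Measure (Grd d)) (ν : Measure (EdgeGrd d)) : Prop :=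
  ∀ (r : ℕ) (hr : 1 ≤ r) (A : EdgeRootedGraph d), A.toRootedGraph.IsBall r →
    ν (EdgeGrd.cyl r hr (EdgeGrd.mk A)) =
      (A.multiplicity : ENNReal) * μ (Grd.cyl r (Grd.mk A.toRootedGraph))

/-- `μ` is involution-invariant: the induced measure on the space of rooted graphs with a
distinguished edge is invariant under the involution. -/
def IsInvolutionInvariant {d : ℕ} (μ : Measure (Grd d)) : Prop :=
  ∃ ν : Measure (EdgeGrd d), IsInducedEdgeMeasure μ ν ∧ MeasurePreserving EdgeGrd.flip ν ν

/-! ## Finite graphs and their local limits -/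

/-- Finite simple graphs with all degrees at most `d`. -/
structure FinGraph (d : ℕ) : Type 1 where
  V : Type
  finite : Finite V
  graph : SimpleGraph V
  deg_le : DegLE graph d

namespace FinGraph

variable {d : ℕ}

/-- The isomorphism class of the rooted ball of radius `r` around the vertex `x`. -/
def ballClass (G : FinGraph d) (r : ℕ) (x : G.V) : Grd d :=
  haveI := G.finite
  Grd.mk (RootedGraph.ballAt G.graph G.deg_le x r)

/-- The fraction of the vertices of `G` whose `r`-ball is `α`. -/
noncomputable def freq (G : FinGraph d) (r : ℕ) (α : Grd d) : ℝ :=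
  ({x | G.ballClass r x = α}.ncard : ℝ) / (Nat.card G.V : ℝ)

end FinGraph

/-- The number of vertices tends to infinity and all the frequencies of balls converge. -/
def WeaklyConvergent {d : ℕ} (G : ℕ → FinGraph d) : Prop :=
  Tendsto (fun n => Nat.card (G n).V) atTop atTop ∧
    ∀ (r : ℕ), ∀ α ∈ Grd.balls d r, ∃ p : ℝ, Tendsto (fun n => (G n).freq r α) atTop (𝓝 p)

/-- `μ` is the local limit measure of the sequence `G`. -/
def IsLocalLimit {d : ℕ} (G : ℕ → FinGraph d) (μ : Measure (Grd d)) : Prop :=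
  ∀ (r : ℕ), ∀ α ∈ Grd.balls d r,
    Tendsto (fun n => (G n).freq r α) atTop (𝓝 (μ (Grd.cyl r α)).toReal)

end LocalLimit

/-!
For a tree, the local statistics can be encoded by *shapes*: the shape of a rooted tree, cut off at
depth `n + 1`, is the multiset of the shapes, cut off at depth `n`, of the branches at the root.
Finite rooted trees are determined by their shape (`exists_iso_of_shape_eq`). Hence a sequence of
finite graphs `G n` whose balls of radius at most `n + 1` are trees converges to `μ` as soon as the
proportion of vertices of a given shape tends to the `μ`-probability of that shape.

An edge `(x, y)` of a tree splits it into a branch at `y` and a branch at `x`. The shape of the tree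
seen from `x` to depth `R + 1` determines, for each edge at `x`, the pair `(a, b)` of the shapes to
depth `R` of these two branches. Involution invariance says that the expected number of edges of
type `(a, b)` at the root equals the expected number of edges of type `(b, a)`
(`sum_edgeCount_comm`). This is a finite system of linear equations with integral coefficients for
the probabilities of the shapes. Applying to the probabilities a `ℚ`-linear map `ℝ → ℚ` that is
close to the identity on them, one obtains nearby rational solutions (`exists_nat_weights`).

Given such a solution, take a number of vertices of each shape proportional to its weight, attach
to each vertex the half-edges that its shape asks for, and match the half-edges of type `(a, b)`
with those of type `(b, a)`; the equations are exactly what makes this possible. The resulting finite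
multigraph has the prescribed shapes in its universal cover. It remains to pass to a finite cover
without short cycles. To this end, give all edges different colours, let every colour `c` act as an
involution `gen m c` on the finite set of reduced words of length at most `m` by "multiply with `c`
from the left", and let crossing an edge of colour `c` multiply by this permutation. A reduced
product of at most `m` of these permutations takes the empty word to the word that spells it, so
the balls of radius less than `m` in the cover are trees (`treeLike_of_gen`), and the shapes are the
prescribed ones (`HalfEdges.ballShape_cover`, `exists_finGraph_of_balanced`).
-/

namespace LocalLimit

/-! ### Shapes of rooted trees -/

/-- Isomorphism types of rooted trees cut off at depth `n`: such a type is the multiset of the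
types, cut off at depth `n - 1`, of the branches at the root. -/
@[reducible] def Shape : ℕ → Type
  | 0 => Unit
  | n + 1 => Multiset (Shape n)

namespace Shape

/-- Cut a shape of depth `n` off at depth `j`. The value is junk when `n < j`. -/
def cut : (n j : ℕ) → Shape n → Shape j
  | _, 0, _ => ()
  | 0, _ + 1, _ => (0 : Multiset _)
  | n + 1, j + 1, t => Multiset.map (cut n j) t

theorem cut_succ (n j : ℕ) (t : Multiset (Shape n)) :
    cut (n + 1) (j + 1) t = t.map (cut n j) := rfl

theorem cut_cut {n k j : ℕ} (hjk : j ≤ k) (hkn : k ≤ n) (t : Shape n) :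
    cut k j (cut n k t) = cut n j t := by
  induction j generalizing n k with
  | zero => rfl
  | succ j ih =>
    obtain ⟨k, rfl⟩ := Nat.exists_eq_add_one_of_ne_zero (by omega : k ≠ 0)
    obtain ⟨n, rfl⟩ := Nat.exists_eq_add_one_of_ne_zero (by omega : n ≠ 0)
    rw [cut_succ, cut_succ, cut_succ, Multiset.map_map]
    exact Multiset.map_congr rfl fun a _ => ih (by omega) (by omega) a

theorem cut_self (n : ℕ) (t : Shape n) : cut n n t = t := by
  induction n with
  | zero => rfl
  | succ n ih =>
    rw [cut_succ]
    exact (Multiset.map_congr rfl fun a _ => ih a).trans (Multiset.map_id t)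

/-- The shapes of depth `n` all of whose multisets of branches have at most `d` elements. -/
def bounded (d : ℕ) : (n : ℕ) → Set (Shape n)
  | 0 => Set.univ
  | n + 1 => {t : Multiset (Shape n) | t.card ≤ d ∧ ∀ a ∈ t, a ∈ bounded d n}

theorem finite_bounded (d n : ℕ) : (bounded d n).Finite := by
  classical
  induction n with
  | zero => exact Set.toFinite (α := Unit) _
  | succ n ih =>
    refine (Set.finite_Iic (d • ih.toFinset.val)).subset ?_
    rintro t ⟨ht, h⟩
    refine Multiset.le_iff_count.2 fun a => ?_
    by_cases ha : a ∈ t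
    · rw [Multiset.count_nsmul, Multiset.count_eq_one_of_mem ih.toFinset.nodup (by simpa using h a ha)]
      simpa using (Multiset.count_le_card a t).trans ht
    · simp [Multiset.count_eq_zero_of_notMem ha]

end Shape

/-! ### Shapes of balls in a graph -/

section ShapeOfBall

variable {V W : Type}

open Classical in
/-- The neighbours of `x` as a finset; the junk value `∅` is taken if there are infinitely many. -/
noncomputable def nbrs (G : SimpleGraph V) (x : V) : Finset V :=
  if h : (G.neighborSet x).Finite then h.toFinset else ∅

theorem mem_nbrs {G : SimpleGraph V} {d : ℕ} (hG : DegLE G d) {x y : V} :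
    y ∈ nbrs G x ↔ G.Adj x y := by
  have h : (G.neighborSet x).Finite :=
    Set.finite_of_encard_le_coe (hG x)
  rw [nbrs, dif_pos h]
  simp

theorem card_nbrs_le {G : SimpleGraph V} {d : ℕ} (hG : DegLE G d) (x : V) :
    (nbrs G x).card ≤ d := by
  have h : ((nbrs G x : Set V)) = G.neighborSet x := by
    ext y; simp [mem_nbrs hG]
  have := hG x
  rw [← h, Set.encard_coe_eq_coe_finsetCard] at this
  exact_mod_cast this

open Classical in
/-- The shape, to depth `n`, of what is seen from `x` when one never walks back, starting with a
prohibition to step to `y`. In a tree this is the branch at `x` away from `y`. -/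
noncomputable def coneShape (G : SimpleGraph V) : (n : ℕ) → (x y : V) → Shape n
  | 0, _, _ => ()
  | n + 1, x, y => ((nbrs G x).erase y).val.map fun z => coneShape G n z x

/-- The shape, to depth `n`, of the universal cover of `G` seen from `x`. If the `n`-ball around
`x` is a tree, this is the isomorphism type of that ball. -/
noncomputable def ballShape (G : SimpleGraph V) : (n : ℕ) → V → Shape n
  | 0, _ => ()
  | n + 1, x => (nbrs G x).val.map fun z => coneShape G n z x

theorem coneShape_succ [DecidableEq V] (G : SimpleGraph V) (n : ℕ) (x y : V) :
    coneShape G (n + 1) x y = ((nbrs G x).erase y).val.map fun z => coneShape G n z x := by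
  simp only [coneShape]
  congr!

theorem ballShape_succ (G : SimpleGraph V) (n : ℕ) (x : V) :
    ballShape G (n + 1) x = (nbrs G x).val.map fun z => coneShape G n z x := rfl

theorem cut_coneShape (G : SimpleGraph V) {n j : ℕ} (h : j ≤ n) (x y : V) :
    Shape.cut n j (coneShape G n x y) = coneShape G j x y := by
  classical
  induction j generalizing n x y with
  | zero => rfl
  | succ j ih =>
    obtain ⟨n, rfl⟩ := Nat.exists_eq_add_one_of_ne_zero (by omega : n ≠ 0)
    rw [coneShape_succ, coneShape_succ, Shape.cut_succ, Multiset.map_map]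
    exact Multiset.map_congr rfl fun a _ => ih (by omega) a x

theorem cut_ballShape (G : SimpleGraph V) {n j : ℕ} (h : j ≤ n) (x : V) :
    Shape.cut n j (ballShape G n x) = ballShape G j x := by
  cases j with
  | zero => rfl
  | succ j =>
    obtain ⟨n, rfl⟩ := Nat.exists_eq_add_one_of_ne_zero (by omega : n ≠ 0)
    rw [ballShape_succ, ballShape_succ, Shape.cut_succ, Multiset.map_map]
    exact Multiset.map_congr rfl fun a _ => cut_coneShape G (by omega) a x

theorem ballShape_erase [∀ n, DecidableEq (Shape n)] {G : SimpleGraph V} {d : ℕ} (hG : DegLE G d) (n : ℕ) {x y : V}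
    (h : G.Adj x y) :
    Multiset.erase (ballShape G (n + 1) x) (coneShape G n y x) = coneShape G (n + 1) x y := by
  classical
  rw [ballShape_succ, coneShape_succ, Finset.erase_val,
    Multiset.map_erase_of_mem _ _ (show y ∈ (nbrs G x).val from (mem_nbrs hG).2 h)]

theorem coneShape_mem_bounded {G : SimpleGraph V} {d : ℕ} (hG : DegLE G d) (n : ℕ) (x y : V) :
    coneShape G n x y ∈ Shape.bounded d n := by
  classical
  induction n generalizing x y with
  | zero => trivial
  | succ n ih =>
    rw [coneShape_succ]
    refine ⟨?_, fun a ha => ?_⟩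
    · rw [Multiset.card_map]
      exact (Finset.card_le_card (Finset.erase_subset _ _)).trans (card_nbrs_le hG x)
    · obtain ⟨z, -, rfl⟩ := Multiset.mem_map.1 ha
      exact ih z x

theorem ballShape_mem_bounded {G : SimpleGraph V} {d : ℕ} (hG : DegLE G d) (n : ℕ) (x : V) :
    ballShape G n x ∈ Shape.bounded d n := by
  cases n with
  | zero => trivial
  | succ n =>
    rw [ballShape_succ]
    refine ⟨?_, fun a ha => ?_⟩
    · rw [Multiset.card_map]
      exact card_nbrs_le hG x
    · obtain ⟨z, -, rfl⟩ := Multiset.mem_map.1 ha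
      exact coneShape_mem_bounded hG n z x

/-- Shapes to depth `n` are preserved by an injective map which restricts to a bijection of the
neighbours at every vertex that matters. Here `P k z` says that the neighbourhood of radius `k` of
`z` matters. -/
theorem coneShape_map {G : SimpleGraph V} {H : SimpleGraph W} {d e : ℕ} (hG : DegLE G d)
    (hH : DegLE H e) (f : V → W) (hf : Function.Injective f) (P : ℕ → V → Prop)
    (hP : ∀ k z w, P (k + 1) z → G.Adj z w → P k w)
    (hadj : ∀ z w, G.Adj z w → H.Adj (f z) (f w))
    (hsurj : ∀ k z w', P (k + 1) z → H.Adj (f z) w' → ∃ w, G.Adj z w ∧ f w = w')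
    (n : ℕ) (z y : V) (hz : P n z) :
    coneShape G n z y = coneShape H n (f z) (f y) := by
  classical
  induction n generalizing z y with
  | zero => rfl
  | succ n ih =>
    rw [coneShape_succ, coneShape_succ]
    refine Multiset.map_eq_map_of_bij_of_nodup _ _ (Finset.nodup _) (Finset.nodup _)
      (fun a _ => f a) ?_ (fun _ _ _ _ h => hf h) ?_ ?_
    · intro a ha
      simp only [Finset.mem_val, Finset.mem_erase, mem_nbrs hG, mem_nbrs hH] at ha ⊢
      exact ⟨fun h => ha.1 (hf h), hadj _ _ ha.2⟩
    · intro b hb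
      simp only [Finset.mem_val, Finset.mem_erase, mem_nbrs hH] at hb
      obtain ⟨w, hw, rfl⟩ := hsurj _ _ _ hz hb.2
      exact ⟨w, Finset.mem_erase.2 ⟨fun h => hb.1 (congrArg f h), (mem_nbrs hG).2 hw⟩, rfl⟩
    · intro a ha
      simp only [Finset.mem_val, Finset.mem_erase, mem_nbrs hG] at ha
      exact ih a z (hP _ _ _ hz ha.2)

theorem ballShape_map {G : SimpleGraph V} {H : SimpleGraph W} {d e : ℕ} (hG : DegLE G d)
    (hH : DegLE H e) (f : V → W) (hf : Function.Injective f) (P : ℕ → V → Prop)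
    (hP : ∀ k z w, P (k + 1) z → G.Adj z w → P k w)
    (hadj : ∀ z w, G.Adj z w → H.Adj (f z) (f w))
    (hsurj : ∀ k z w', P (k + 1) z → H.Adj (f z) w' → ∃ w, G.Adj z w ∧ f w = w')
    (n : ℕ) (z : V) (hz : P n z) :
    ballShape G n z = ballShape H n (f z) := by
  classical
  cases n with
  | zero => rfl
  | succ n =>
    rw [ballShape_succ, ballShape_succ]
    refine Multiset.map_eq_map_of_bij_of_nodup _ _ (Finset.nodup _) (Finset.nodup _)
      (fun a _ => f a) ?_ (fun _ _ _ _ h => hf h) ?_ ?_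
    · intro a ha
      simp only [Finset.mem_val, mem_nbrs hG, mem_nbrs hH] at ha ⊢
      exact hadj _ _ ha
    · intro b hb
      simp only [Finset.mem_val, mem_nbrs hH] at hb
      obtain ⟨w, hw, rfl⟩ := hsurj _ _ _ hz hb
      exact ⟨w, by simpa [mem_nbrs hG] using hw, rfl⟩
    · intro a ha
      simp only [Finset.mem_val, mem_nbrs hG] at ha
      exact coneShape_map hG hH f hf P hP hadj hsurj n a z (hP _ _ _ hz ha)

theorem coneShape_iso {G : SimpleGraph V} {H : SimpleGraph W} {d e : ℕ} (hG : DegLE G d)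
    (hH : DegLE H e) (f : G ≃g H) (n : ℕ) (z y : V) :
    coneShape G n z y = coneShape H n (f z) (f y) :=
  coneShape_map hG hH f f.injective (fun _ _ => True) (fun _ _ _ _ _ => trivial)
    (fun _ _ h => f.map_adj_iff.2 h)
    (fun _ z w' _ h => ⟨f.symm w', by
      rw [← f.map_adj_iff]; simpa using h, by simp⟩) n z y trivial

theorem ballShape_iso {G : SimpleGraph V} {H : SimpleGraph W} {d e : ℕ} (hG : DegLE G d)
    (hH : DegLE H e) (f : G ≃g H) (n : ℕ) (z : V) :
    ballShape G n z = ballShape H n (f z) :=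
  ballShape_map hG hH f f.injective (fun _ _ => True) (fun _ _ _ _ _ => trivial)
    (fun _ _ h => f.map_adj_iff.2 h)
    (fun _ z w' _ h => ⟨f.symm w', by
      rw [← f.map_adj_iff]; simpa using h, by simp⟩) n z trivial

theorem ballSet_step {G : SimpleGraph V} {x z w : V} {k : ℕ} (hz : z ∈ ballSet G x k)
    (h : G.Adj z w) : w ∈ ballSet G x (k + 1) := by
  obtain ⟨p, hp⟩ := mem_ballSet_iff.1 hz
  exact mem_ballSet_of_walk (p.concat h) (by simpa using hp)

theorem ballSet_mono {G : SimpleGraph V} {x : V} {j k : ℕ} (h : j ≤ k) :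
    ballSet G x j ⊆ ballSet G x k := fun _ hz =>
  le_trans (show G.edist x _ ≤ j from hz) (by exact_mod_cast h)

/-- The `r`-ball around `x` determines the shapes that only involve vertices inside it. -/
theorem coneShape_induce {G : SimpleGraph V} {d : ℕ} (hG : DegLE G d) (x : V) (r n j : ℕ)
    (hr : j + n ≤ r) (z y : ballSet G x r) (hz : (z : V) ∈ ballSet G x j) :
    coneShape (G.induce (ballSet G x r)) n z y = coneShape G n z y := by
  refine coneShape_map (hG.induce _) hG Subtype.val Subtype.val_injective
    (fun k z => ∃ j, j + k ≤ r ∧ (z : V) ∈ ballSet G x j) ?_ (fun _ _ h => h) ?_ n z y ⟨j, hr, hz⟩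
  · rintro k z w ⟨j, hj, hz⟩ h
    exact ⟨j + 1, by omega, ballSet_step hz h⟩
  · rintro k z w ⟨j, hj, hz⟩ h
    refine ⟨⟨w, ?_⟩, h, rfl⟩
    exact ballSet_mono (by omega) (ballSet_step hz h)

theorem ballShape_induce {G : SimpleGraph V} {d : ℕ} (hG : DegLE G d) (x : V) (r : ℕ) :
    ballShape (G.induce (ballSet G x r)) r ⟨x, mem_ballSet_self G x r⟩ = ballShape G r x := by
  refine ballShape_map (hG.induce _) hG Subtype.val Subtype.val_injective
    (fun k z => ∃ j, j + k ≤ r ∧ (z : V) ∈ ballSet G x j) ?_ (fun _ _ h => h) ?_ r _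
      ⟨0, by omega, mem_ballSet_self G x 0⟩
  · rintro k z w ⟨j, hj, hz⟩ h
    exact ⟨j + 1, by omega, ballSet_step hz h⟩
  · rintro k z w ⟨j, hj, hz⟩ h
    refine ⟨⟨w, ?_⟩, h, rfl⟩
    exact ballSet_mono (by omega) (ballSet_step hz h)

end ShapeOfBall

/-! ### Rooted trees are determined by their shape -/

section TreeLike

variable {V W : Type}

/-- Seen from `x`, the graph `G` looks like a rooted tree: no edge joins two vertices at the same
distance from `x`, and every vertex has at most one neighbour that is closer to `x`. -/
def TreeLike (G : SimpleGraph V) (x : V) : Prop :=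
  (∀ y z, G.Adj y z → G.dist x y ≠ G.dist x z) ∧
    ∀ y u u', G.Adj u y → G.Adj u' y → G.dist x u < G.dist x y → G.dist x u' < G.dist x y → u = u'

/-- In a tree, a neighbour of `y` that is closer to `x` is the last vertex before `y` on the unique
path from `x` to `y`. -/
theorem treeLike_of_isTree {G : SimpleGraph V} (h : G.IsTree) (x : V) : TreeLike G x := by
  refine ⟨fun y z hyz => h.dist_ne_of_adj x hyz, fun y u u' hu hu' hlt hlt' => ?_⟩
  have key : ∀ v, G.Adj v y → G.dist x v < G.dist x y →
      ∃ p : G.Walk x y, p.IsPath ∧ p.penultimate = v := by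
    intro v hv hlt
    obtain ⟨q, hq⟩ := h.connected.exists_walk_length_eq_dist x v
    refine ⟨q.concat hv, SimpleGraph.Walk.isPath_of_length_eq_dist _ ?_, by simp⟩
    refine le_antisymm ?_ (SimpleGraph.dist_le _)
    rw [SimpleGraph.Walk.length_concat]
    omega
  obtain ⟨p, hp, rfl⟩ := key u hu hlt
  obtain ⟨q, hq, rfl⟩ := key u' hu' hlt'
  rw [(h.existsUnique_path x y).unique hp hq]

theorem dist_iso {G : SimpleGraph V} {H : SimpleGraph W} (f : G ≃g H) (x y : V) :
    H.dist (f x) (f y) = G.dist x y := by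
  have key : ∀ {V W : Type} {G : SimpleGraph V} {H : SimpleGraph W} (f : G ≃g H) (x y : V),
      H.edist (f x) (f y) ≤ G.edist x y := by
    intro V W G H f x y
    refine le_iInf fun p => ?_
    simpa using SimpleGraph.edist_le (p.map f.toHom)
  refine congrArg ENat.toNat (le_antisymm (key f x y) ?_)
  simpa using key f.symm (f x) (f y)

theorem TreeLike.iso {G : SimpleGraph V} {H : SimpleGraph W} {x : V} (h : TreeLike G x)
    (f : G ≃g H) : TreeLike H (f x) := by
  refine ⟨fun y z hyz => ?_, fun y u u' hu hu' hlt hlt' => ?_⟩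
  · rw [← f.apply_symm_apply y, ← f.apply_symm_apply z] at *
    generalize f.symm y = y at *
    generalize f.symm z = z at *
    simp only [dist_iso, f.map_adj_iff] at *
    exact h.1 y z hyz
  · rw [← f.apply_symm_apply y, ← f.apply_symm_apply u] at *
    rw [← f.apply_symm_apply u'] at *
    generalize f.symm y = y at *
    generalize f.symm u = u at *
    generalize f.symm u' = u' at *
    simp only [dist_iso, f.map_adj_iff] at *
    exact congrArg f (h.2 y u u' hu hu' hlt hlt')

open Classical in
/-- The neighbours of `y` that are further away from `x` than `y` is. -/
noncomputable def children (G : SimpleGraph V) (x y : V) : Finset V :=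
  (nbrs G y).filter fun z => G.dist x y < G.dist x z

theorem mem_children {G : SimpleGraph V} {d : ℕ} (hG : DegLE G d) {x y z : V} :
    z ∈ children G x y ↔ G.Adj y z ∧ G.dist x y < G.dist x z := by
  simp [children, mem_nbrs hG]

theorem dist_child {G : SimpleGraph V} {d : ℕ} (hG : DegLE G d) (hc : G.Connected) {x y z : V}
    (h : z ∈ children G x y) : G.dist x z = G.dist x y + 1 := by
  obtain ⟨h, hlt⟩ := (mem_children hG).1 h
  obtain ⟨q, hq⟩ := hc.exists_walk_length_eq_dist x y
  have := SimpleGraph.dist_le (q.concat h)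
  rw [SimpleGraph.Walk.length_concat] at this
  omega

/-- Every vertex except the root is the child of some vertex. -/
theorem exists_parent {G : SimpleGraph V} {d : ℕ} (hG : DegLE G d) (hc : G.Connected) {x y : V}
    (h : y ≠ x) : ∃ u, y ∈ children G x u := by
  obtain ⟨q, hq⟩ := hc.exists_walk_length_eq_dist x y
  have hn : ¬ q.Nil := fun hq => h hq.eq.symm
  refine ⟨q.penultimate, (mem_children hG).2 ⟨q.adj_penultimate hn, ?_⟩⟩
  have := SimpleGraph.dist_le q.dropLast
  have h0 : q.length ≠ 0 := fun h0 => hn (SimpleGraph.Walk.length_eq_zero_iff.1 h0)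
  simp at this
  omega

/-- The shape, to depth `n`, of the part of a rooted tree that lies below `y`. -/
noncomputable def descShape (G : SimpleGraph V) (x : V) : (n : ℕ) → V → Shape n
  | 0, _ => ()
  | n + 1, y => (children G x y).val.map fun z => descShape G x n z

/-- For a vertex `y` of a rooted tree, never to walk back to the parent means to walk downwards. -/
theorem coneShape_eq_descShape {G : SimpleGraph V} {d : ℕ} (hG : DegLE G d) {x : V}
    (ht : TreeLike G x) (n : ℕ) {u y : V} (h : y ∈ children G x u) :
    coneShape G n y u = descShape G x n y := by
  classical
  induction n generalizing u y with
  | zero => rfl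
  | succ n ih =>
    have hs : (nbrs G y).erase u = children G x y := by
      ext z
      rw [mem_children hG] at h ⊢
      rw [Finset.mem_erase, mem_nbrs hG]
      refine and_comm.trans (and_congr_right fun hz => ⟨fun hne => ?_, fun hlt he => ?_⟩)
      · by_contra hlt
        exact hne (ht.2 y z u hz.symm h.1 (by have := ht.1 _ _ hz; omega) h.2)
      · subst he
        exact absurd h.2 (by omega)
    rw [coneShape_succ, hs]
    exact Multiset.map_congr rfl fun z hz => ih hz

theorem ballShape_eq_descShape {G : SimpleGraph V} {d : ℕ} (hG : DegLE G d)
    {x : V} (ht : TreeLike G x) (n : ℕ) : ballShape G n x = descShape G x n x := by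
  cases n with
  | zero => rfl
  | succ n =>
    have hs : nbrs G x = children G x x := by
      ext z
      rw [mem_children hG, mem_nbrs hG]
      refine ⟨fun hz => ⟨hz, ?_⟩, And.left⟩
      have := ht.1 _ _ hz
      rw [SimpleGraph.dist_self] at this ⊢
      omega
    rw [ballShape_succ, hs]
    exact Multiset.map_congr rfl fun z hz => coneShape_eq_descShape hG ht n hz

/-- Two equal multisets of values come from a bijection of the index sets. -/
theorem exists_bijOn_of_map_eq {C : Type} {s : Finset V} {t : Finset W} {f : V → C} {g : W → C}
    (h : s.val.map f = t.val.map g) (w : W) :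
    ∃ σ : V → W, Set.BijOn σ s t ∧ ∀ a ∈ s, g (σ a) = f a := by
  classical
  have hcard : ∀ c, Nonempty ({a : s // f a = c} ≃ {b : t // g b = c}) := by
    intro c
    have h1 := congrArg (Multiset.count c) h
    rw [Multiset.count_map, Multiset.count_map] at h1
    rw [← Fintype.card_eq, Fintype.card_subtype, Fintype.card_subtype,
      Finset.univ_eq_attach, Finset.univ_eq_attach, ← Finset.card_map (Function.Embedding.subtype _),
      ← Finset.card_map (Function.Embedding.subtype (· ∈ t))]
    convert h1 using 1
    · rw [← Finset.filter_val, Finset.card_val]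
      congr 1
      ext a
      simp [eq_comm, and_comm]
    · rw [← Finset.filter_val, Finset.card_val]
      congr 1
      ext a
      simp [eq_comm, and_comm]
  let e := fun c => (hcard c).some
  have he := Equiv.ofFiberEquiv_map e
  set E : s ≃ t := Equiv.ofFiberEquiv e
  refine ⟨fun a => if ha : a ∈ s then E ⟨a, ha⟩ else w, ⟨?_, ?_, ?_⟩, ?_⟩
  · intro a ha
    rw [Finset.mem_coe] at ha
    simp [ha]
  · intro a ha b hb hab
    rw [Finset.mem_coe] at ha hb
    simpa [ha, hb] using hab
  · intro b hb
    refine ⟨E.symm ⟨b, hb⟩, (E.symm ⟨b, hb⟩).2, ?_⟩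
    simp
  · intro a ha
    simpa [ha] using he ⟨a, ha⟩

/-- Finite rooted trees of height at most `r` with the same shape are isomorphic. The isomorphism
is built from the root downwards, by choosing for every vertex and its image a bijection of their
children that preserves the shapes below them. -/
theorem exists_iso_of_shape_eq {G : SimpleGraph V} {H : SimpleGraph W} {d : ℕ} (hG : DegLE G d)
    (hH : DegLE H d) (hGc : G.Connected) (hHc : H.Connected) {x : V} {y : W} (hGt : TreeLike G x)
    (hHt : TreeLike H y) {r : ℕ} (hGr : ∀ v, G.dist x v ≤ r) (hHr : ∀ v, H.dist y v ≤ r)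
    (h : ballShape G r x = ballShape H r y) : ∃ f : G ≃g H, f x = y := by
  classical
  -- `u` and `u'` are at the same level and what lies below them, down to level `r`, looks the same
  let Good (u : V) (u' : W) : Prop := H.dist y u' = G.dist x u ∧
    descShape G x (r - G.dist x u) u = descShape H y (r - G.dist x u) u'
  have hσ : ∀ u u', ∃ σ : V → W, Good u u' →
      Set.BijOn σ (children G x u) (children H y u') ∧ ∀ z ∈ children G x u, Good z (σ z) := by
    intro u u'
    by_cases hg : Good u u'
    swap
    · exact ⟨fun _ => y, fun h => absurd h hg⟩
    obtain ⟨hd, hs⟩ := hg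
    obtain hlt | heq := (hGr u).lt_or_eq
    · obtain ⟨k, hk⟩ : ∃ k, r - G.dist x u = k + 1 := ⟨r - G.dist x u - 1, by omega⟩
      rw [hk] at hs
      obtain ⟨σ, h1, h2⟩ := exists_bijOn_of_map_eq hs y
      refine ⟨σ, fun _ => ⟨h1, fun z hz => ?_⟩⟩
      have e1 := dist_child hG hGc hz
      have e2 := dist_child hH hHc (h1.mapsTo hz)
      refine ⟨by omega, ?_⟩
      rw [show r - G.dist x z = k by omega]
      exact (h2 z hz).symm
    · have c1 : children G x u = ∅ := Finset.eq_empty_of_forall_notMem fun z hz => by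
        have := dist_child hG hGc hz
        have := hGr z
        omega
      have c2 : children H y u' = ∅ := Finset.eq_empty_of_forall_notMem fun z hz => by
        have := dist_child hH hHc hz
        have := hHr z
        omega
      exact ⟨fun _ => y, fun _ => by simp [c1, c2]⟩
  choose σ hσ using hσ
  choose! par hpar using fun (v : V) (hv : v ≠ x) => exists_parent hG hGc hv
  -- the image of a vertex at distance `n`, by recursion on `n`
  let F : ℕ → V → W := fun n => Nat.rec (fun _ => y) (fun _ F v => σ (par v) (F (par v)) v) n
  let f : V → W := fun v => F (G.dist x v) v
  have fx : f x = y := by simp [f, F]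
  have dpar : ∀ v, v ≠ x → G.dist x v = G.dist x (par v) + 1 := fun v hv =>
    dist_child hG hGc (hpar v hv)
  have fstep : ∀ v, v ≠ x → f v = σ (par v) (f (par v)) v := by
    intro v hv
    simp only [f, dpar v hv, F]
  have ne_root : ∀ u v, v ∈ children G x u → v ≠ x := by
    rintro u v hv rfl
    have := dist_child hG hGc hv
    rw [SimpleGraph.dist_self] at this
    omega
  have ne_root' : ∀ u v, v ∈ children H y u → v ≠ y := by
    rintro u v hv rfl
    have := dist_child hH hHc hv
    rw [SimpleGraph.dist_self] at this
    omega
  have par_unique : ∀ u v, v ∈ children G x u → par v = u := by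
    intro u v hv
    have h1 := (mem_children hG).1 hv
    have h2 := (mem_children hG).1 (hpar v (ne_root u v hv))
    exact hGt.2 v _ _ h2.1 h1.1 h2.2 h1.2
  have par_unique' : ∀ u u' v, v ∈ children H y u → v ∈ children H y u' → u = u' := by
    intro u u' v hv hv'
    have h1 := (mem_children hH).1 hv
    have h2 := (mem_children hH).1 hv'
    exact hHt.2 v _ _ h1.1 h2.1 h1.2 h2.2
  have good : ∀ n v, G.dist x v = n → Good v (f v) := by
    intro n
    induction n with
    | zero =>
      intro v hv
      obtain rfl := (hGc.dist_eq_zero_iff).1 hv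
      rw [fx]
      refine ⟨by simp, ?_⟩
      rw [SimpleGraph.dist_self, Nat.sub_zero, ← ballShape_eq_descShape hG hGt,
        ← ballShape_eq_descShape hH hHt, h]
    | succ n ih =>
      intro v hv
      have hvx : v ≠ x := by rintro rfl; simp at hv
      rw [fstep v hvx]
      exact (hσ _ _ (ih (par v) (by have := dpar v hvx; omega))).2 v (hpar v hvx)
  have bij : ∀ u, Set.BijOn (σ u (f u)) (children G x u) (children H y (f u)) := fun u =>
    (hσ _ _ (good _ u rfl)).1
  have fchild : ∀ u v, v ∈ children G x u → f v ∈ children H y (f u) := by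
    intro u v hv
    rw [fstep v (ne_root u v hv), par_unique u v hv]
    exact (bij u).mapsTo hv
  have inj : ∀ n v w, G.dist x v = n → f v = f w → v = w := by
    intro n
    induction n with
    | zero =>
      intro v w hv hvw
      have h1 := (good _ v rfl).1
      have h2 := (good _ w rfl).1
      rw [hvw] at h1
      obtain rfl := (hGc.dist_eq_zero_iff).1 hv
      exact (hGc.dist_eq_zero_iff).1 (by omega)
    | succ n ih =>
      intro v w hv hvw
      have h1 := (good _ v rfl).1
      have h2 := (good _ w rfl).1
      rw [hvw] at h1
      have hvx : v ≠ x := by rintro rfl; simp at hv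
      have hwx : w ≠ x := by
        intro hwx
        rw [hwx, SimpleGraph.dist_self] at h2
        rw [hwx] at h1
        omega
      have hp : par v = par w := by
        refine ih _ _ (by have := dpar v hvx; omega) ?_
        refine par_unique' _ _ (f v) (fchild _ _ (hpar v hvx)) ?_
        rw [hvw]
        exact fchild _ _ (hpar w hwx)
      have hp2 := hpar w hwx
      rw [← hp] at hp2
      rw [fstep v hvx, fstep w hwx, ← hp] at hvw
      exact (bij _).injOn (hpar v hvx) hp2 hvw
  have surj : ∀ n v', H.dist y v' = n → ∃ v, f v = v' := by
    intro n
    induction n with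
    | zero =>
      intro v' hv
      obtain rfl := (hHc.dist_eq_zero_iff).1 hv
      exact ⟨x, fx⟩
    | succ n ih =>
      intro v' hv
      have hvy : v' ≠ y := by rintro rfl; simp at hv
      obtain ⟨u', hu'⟩ := exists_parent hH hHc hvy
      obtain ⟨u, rfl⟩ := ih u' (by have := dist_child hH hHc hu'; omega)
      obtain ⟨v, hvu, rfl⟩ := (bij u).surjOn hu'
      exact ⟨v, by rw [fstep v (ne_root u v hvu), par_unique u v hvu]⟩
  have adj_iff : ∀ {V : Type} {G : SimpleGraph V} {x : V} (_ : DegLE G d) (_ : TreeLike G x)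
      (u v : V), G.Adj u v ↔ v ∈ children G x u ∨ u ∈ children G x v := by
    intro V G x hG hGt u v
    rw [mem_children hG, mem_children hG]
    refine ⟨fun h => ?_, fun h => h.elim And.left fun h => h.1.symm⟩
    have := hGt.1 _ _ h
    obtain h' | h' := this.lt_or_gt
    · exact Or.inl ⟨h, h'⟩
    · exact Or.inr ⟨h.symm, h'⟩
  have child_iff : ∀ u v, f v ∈ children H y (f u) ↔ v ∈ children G x u := by
    refine fun u v => ⟨fun hv => ?_, fchild u v⟩
    have hvx : v ≠ x := by
      rintro rfl
      exact ne_root' _ _ hv fx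
    have := par_unique' _ _ _ hv (fchild _ _ (hpar v hvx))
    rw [inj _ _ _ rfl this]
    exact hpar v hvx
  refine ⟨⟨Equiv.ofBijective f ⟨fun v w => inj _ v w rfl, fun v' => surj _ v' rfl⟩, ?_⟩, fx⟩
  intro u v
  rw [adj_iff hG hGt, adj_iff hH hHt]
  exact or_congr (child_iff u v) (child_iff v u)

end TreeLike

/-! ### Rational approximation preserving linear relations -/

/-- The identity of `ℝ` is a pointwise limit of `ℚ`-linear maps to `ℚ`: move the elements of a
Hamel basis to nearby rationals. -/
theorem exists_linearMap_tendsto :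
    ∃ φ : ℕ → ℝ →ₗ[ℚ] ℚ, ∀ s, Tendsto (fun n => (φ n s : ℝ)) atTop (𝓝 s) := by
  let b := Module.Basis.ofVectorSpace ℚ ℝ
  have hq : ∀ i, ∃ q : ℕ → ℚ, Tendsto (fun n => (q n : ℝ)) atTop (𝓝 (b i)) := by
    intro i
    obtain ⟨q, -, -, hq⟩ := Real.exists_seq_rat_strictMono_tendsto (b i)
    exact ⟨q, hq⟩
  choose q hq using hq
  refine ⟨fun n => b.constr ℚ fun i => q i n, fun s => ?_⟩
  have h : ∀ n, ((b.constr ℚ (fun i => q i n) s : ℚ) : ℝ) =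
      ∑ i ∈ (b.repr s).support, (b.repr s i : ℝ) * (q i n : ℝ) := by
    intro n
    rw [Module.Basis.constr_apply, Finsupp.sum]
    push_cast [smul_eq_mul]
    rfl
  simp_rw [h]
  have hs : s = ∑ i ∈ (b.repr s).support, (b.repr s i : ℝ) * b i := by
    conv_lhs => rw [← b.linearCombination_repr s, Finsupp.linearCombination_apply, Finsupp.sum]
    simp_rw [Rat.smul_def]
  conv => enter [3, 1]; rw [hs]
  exact tendsto_finsetSum _ fun i _ => (hq i).const_mul _

/-- A probability vector can be approximated by the proportions of natural numbers that satisfy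
all integral linear relations satisfied by the vector. -/
theorem exists_nat_weights {ι : Type*} [Fintype ι] (p : ι → ℝ) (hp : ∀ i, 0 ≤ p i)
    (hsum : ∑ i, p i = 1) {ε : ℝ} (hε : 0 < ε) (K : ℕ) :
    ∃ n : ι → ℕ, K ≤ ∑ i, n i ∧ 0 < ∑ i, n i ∧
      (∀ c : ι → ℤ, ∑ i, (c i : ℝ) * p i = 0 → ∑ i, c i * (n i : ℤ) = 0) ∧
      ∀ i, |(n i : ℝ) / (∑ i, n i : ℕ) - p i| < ε := by
  -- the weights are `φ N (p i)`, multiplied by a common denominator `D` and by `K + 1`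
  obtain ⟨φ, hφ⟩ := exists_linearMap_tendsto
  have h1 : ∀ᶠ n in atTop, 0 < (φ n 1 : ℝ) := (hφ 1).eventually (lt_mem_nhds one_pos)
  have h2 : ∀ᶠ n in atTop, ∀ i, 0 ≤ φ n (p i) := by
    refine eventually_all.2 fun i => ?_
    obtain h | h := (hp i).eq_or_lt
    · simp [← h]
    · filter_upwards [(hφ (p i)).eventually (lt_mem_nhds h)] with n hn
      exact_mod_cast hn.le
  have h3 : ∀ᶠ n in atTop, ∀ i, |(φ n (p i) : ℝ) / φ n 1 - p i| < ε := by
    refine eventually_all.2 fun i => ?_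
    have := (hφ (p i)).div (hφ 1) one_ne_zero
    rw [div_one] at this
    exact (Metric.tendsto_nhds.1 this) ε hε
  obtain ⟨N, hN1, hN2, hN3⟩ := (h1.and (h2.and h3)).exists
  have hden : ∀ i, ∃ m : ℕ, (m : ℚ) = φ N (p i) * (∏ j, (φ N (p j)).den : ℕ) := by
    intro i
    obtain ⟨k, hk⟩ := Finset.dvd_prod_of_mem (fun j => (φ N (p j)).den) (Finset.mem_univ i)
    refine ⟨(φ N (p i)).num.toNat * k, ?_⟩
    rw [hk]
    push_cast
    rw [← mul_assoc, Rat.mul_den_eq_num]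
    congr 1
    exact_mod_cast Int.toNat_of_nonneg (Rat.num_nonneg.2 (hN2 i))
  choose m hm using hden
  set D : ℕ := ∏ j, (φ N (p j)).den
  have hD : 0 < D := Finset.prod_pos fun j _ => (φ N (p j)).den_pos
  have hsumφ : ∑ i, φ N (p i) = φ N 1 := by rw [← map_sum, hsum]
  have hmsum : ((∑ i, m i : ℕ) : ℚ) = φ N 1 * D := by
    push_cast
    rw [← hsumφ, Finset.sum_mul]
    exact Finset.sum_congr rfl fun i _ => hm i
  have hφ1 : 0 < φ N 1 := by exact_mod_cast hN1
  have hmpos : 0 < ∑ i, m i := by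
    have : (0 : ℚ) < (∑ i, m i : ℕ) := by rw [hmsum]; positivity
    exact_mod_cast this
  refine ⟨fun i => m i * (K + 1), ?_, ?_, ?_, ?_⟩
  · rw [← Finset.sum_mul]
    nlinarith
  · rw [← Finset.sum_mul]
    positivity
  · intro c hc
    have h0 : ∑ i, (c i : ℚ) * φ N (p i) = 0 := by
      have := congrArg (φ N) hc
      rw [map_sum, map_zero] at this
      rw [← this]
      refine Finset.sum_congr rfl fun i _ => ?_
      have e : (c i : ℝ) * p i = (c i : ℚ) • p i := by rw [Rat.smul_def]; simp
      rw [e, map_smul, smul_eq_mul]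
    have : (∑ i, c i * ((m i * (K + 1) : ℕ) : ℤ) : ℚ) = 0 := by
      calc (∑ i, c i * ((m i * (K + 1) : ℕ) : ℤ) : ℚ)
          = ∑ i, ((c i : ℚ) * φ N (p i)) * (D * (K + 1)) := by
            refine Finset.sum_congr rfl fun i _ => ?_
            push_cast
            rw [hm i]
            ring
        _ = 0 := by rw [← Finset.sum_mul, h0, zero_mul]
    exact_mod_cast this
  · intro i
    convert hN3 i using 3
    rw [← Finset.sum_mul, Nat.cast_mul, Nat.cast_mul, mul_div_mul_right _ _ (by positivity)]
    have e1 : ((m i : ℕ) : ℝ) = (φ N (p i) : ℝ) * D := by exact_mod_cast hm i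
    have e2 : ((∑ i, m i : ℕ) : ℝ) = (φ N 1 : ℝ) * D := by exact_mod_cast hmsum
    rw [e1, e2, mul_div_mul_right _ _ (by positivity)]

/-! ### Involutions without short relations -/

section ReducedWord

variable {C : Type} {m : ℕ}

/-- Words of length at most `m` without two equal consecutive letters. -/
abbrev ReducedWord (C : Type) (m : ℕ) : Type :=
  {l : List C // l.IsChain (· ≠ ·) ∧ l.length ≤ m}

instance [Finite C] : Finite (ReducedWord C m) :=
  ((List.finite_length_le C m).subset fun _ h => h.2).to_subtype

namespace ReducedWord

/-- The empty word. -/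
def nil : ReducedWord C m := ⟨[], by simp, by simp⟩

open Classical in
/-- Multiplication from the left by a generator `c` with `c ^ 2 = 1`; words that would become
longer than `m` are left unchanged. -/
noncomputable def toggle (c : C) (w : ReducedWord C m) : ReducedWord C m :=
  if h : w.1.head? = some c then ⟨w.1.tail, w.2.1.tail, by have := w.2.2; simp; omega⟩
  else if h' : w.1.length < m then
    ⟨c :: w.1, List.isChain_cons.2 ⟨fun y hy he => h (he ▸ hy), w.2.1⟩, by simpa using h'⟩
  else w

theorem toggle_val {c : C} {w : ReducedWord C m} (h : w.1.head? ≠ some c) (h' : w.1.length < m) :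
    (toggle c w).1 = c :: w.1 := by
  rw [toggle, dif_neg h, dif_pos h']

theorem toggle_involutive (c : C) : Function.Involutive (toggle c : ReducedWord C m → _) := by
  intro w
  by_cases h : w.1.head? = some c
  · obtain ⟨l, hl⟩ : ∃ l, w.1 = c :: l := by
      obtain ⟨l, hl⟩ := List.head?_eq_some_iff.1 h
      exact ⟨l, hl⟩
    have hc := w.2.1
    have hlen := w.2.2
    rw [hl, List.isChain_cons] at hc
    rw [hl, List.length_cons] at hlen
    have h1 : (toggle c w).1 = l := by rw [toggle, dif_pos h]; simp [hl]
    apply Subtype.ext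
    rw [toggle_val, h1, hl]
    · rw [h1]
      exact fun h2 => hc.1 c h2 rfl
    · rw [h1]
      omega
  · by_cases h' : w.1.length < m
    · have h1 := toggle_val h h'
      apply Subtype.ext
      rw [toggle, dif_pos (by rw [h1]; rfl)]
      simp [h1]
    · have h1 : toggle c w = w := by rw [toggle, dif_neg h, dif_neg h']
      rw [h1, h1]

/-- The involution attached to the letter `c`. A reduced product of at most `m` of these
involutions takes the empty word to the word that spells the product. -/
noncomputable def gen (m : ℕ) (c : C) : Equiv.Perm (ReducedWord C m) :=
  (toggle_involutive c).toPerm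

theorem gen_apply (c : C) (w : ReducedWord C m) : gen m c w = toggle c w := rfl

theorem gen_mul_self (c : C) : gen m c * gen m c = 1 :=
  Equiv.ext fun w => toggle_involutive c w

theorem gen_nil (c : C) : (gen (m + 1) c nil).1 = [c] := by
  rw [gen_apply, toggle_val] <;> simp [nil]

theorem gen_injective : Function.Injective (gen (C := C) (m + 1)) := by
  intro c c' h
  have := gen_nil (m := m) c
  rw [h, gen_nil] at this
  simpa using this.symm

theorem gen_ne_one (c : C) : gen (m + 1) c ≠ 1 := by
  intro h
  have := gen_nil (m := m) c
  rw [h] at this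
  simp [nil] at this

end ReducedWord

open ReducedWord in
/-- A graph with a proper edge colouring `col` that lies over the Schreier graph of the involutions
`gen m c` is a tree up to distance `r < m`. Indeed, relative to the root, `γ y` takes the empty word
to the word of colours along a shortest path from the root to `y`. -/
theorem treeLike_of_gen {U : Type} {B : SimpleGraph U} (hc : B.Connected) {x : U} {r : ℕ}
    (hr : ∀ y, B.dist x y ≤ r) (hrm : r < m) (γ : U → Equiv.Perm (ReducedWord C m))
    (col : U → U → C) (hγ : ∀ y z, B.Adj y z → γ z = gen m (col y z) * γ y)
    (hsymm : ∀ y z, B.Adj y z → col z y = col y z)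
    (hcol : ∀ y z z', B.Adj y z → B.Adj y z' → col y z = col y z' → z = z') :
    TreeLike B x := by
  let word : U → List C := fun y => ((γ y * (γ x)⁻¹) nil).1
  have hword : ∀ y z, B.Adj y z → (word y).head? ≠ some (col y z) → (word y).length < m →
      word z = col y z :: word y := by
    intro y z h h1 h2
    simp only [word]
    rw [hγ y z h, mul_assoc, Equiv.Perm.mul_apply, gen_apply, toggle_val h1 h2]
  have key : ∀ n y, B.dist x y = n → (word y).length = n ∧
      ∀ z, B.Adj y z → (word y).head? = some (col y z) → B.dist x z < B.dist x y := by
    intro n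
    induction n with
    | zero =>
      intro y hy
      obtain rfl := (hc.dist_eq_zero_iff).1 hy
      simp [word, nil]
    | succ n ih =>
      intro y hy
      obtain ⟨q, hq⟩ := hc.exists_walk_length_eq_dist x y
      have hn : ¬ q.Nil := fun h => by
        rw [SimpleGraph.Walk.length_eq_zero_iff.2 h] at hq
        omega
      have hadj := q.adj_penultimate hn
      set u := q.penultimate
      have hu : B.dist x u = n := by
        have h1 := SimpleGraph.dist_le q.dropLast
        simp only [SimpleGraph.Walk.length_dropLast] at h1
        obtain ⟨q', hq'⟩ := hc.exists_walk_length_eq_dist x u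
        have h2 := SimpleGraph.dist_le (q'.concat hadj)
        rw [SimpleGraph.Walk.length_concat] at h2
        change B.dist x u ≤ _ at h1
        omega
      obtain ⟨h1, h2⟩ := ih u hu
      have h3 : word y = col u y :: word u := by
        refine hword u y hadj (fun h => ?_) ?_
        · have := h2 y hadj h
          omega
        · have := hr u
          omega
      refine ⟨by rw [h3, List.length_cons, h1], fun z hz hh => ?_⟩
      rw [h3, List.head?_cons, Option.some.injEq, ← hsymm u y hadj] at hh
      rw [← hcol y u z hadj.symm hz hh]
      omega
  have hword' : ∀ y z, B.Adj y z → B.dist x y ≤ B.dist x z → word z = col y z :: word y := by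
    intro y z h hlt
    obtain ⟨h1, h2⟩ := key _ y rfl
    refine hword y z h (fun h' => ?_) ?_
    · have := h2 z h h'
      omega
    · have := hr y
      omega
  refine ⟨fun y z h he => ?_, fun y u u' hu hu' hlt hlt' => ?_⟩
  · have h1 := congrArg List.length (hword' y z h he.le)
    rw [List.length_cons, (key _ y rfl).1, (key _ z rfl).1] at h1
    omega
  · have h1 := hword' u y hu hlt.le
    rw [hword' u' y hu' hlt'.le] at h1
    refine hcol y u u' hu.symm hu'.symm ?_
    rw [hsymm u y hu, hsymm u' y hu']
    exact (List.cons.inj h1).1.symm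

end ReducedWord

/-! ### Graphs with prescribed shapes and without short cycles -/

theorem dist_induce_ballSet_le {V : Type} (G : SimpleGraph V) (x : V) (r : ℕ)
    (y : ballSet G x r) :
    (G.induce (ballSet G x r)).edist ⟨x, mem_ballSet_self G x r⟩ y ≤ r := by
  obtain ⟨p, hp⟩ := mem_ballSet_iff.1 y.2
  have hs : ∀ z ∈ p.support, z ∈ ballSet G x r := by
    classical
    intro z hz
    exact mem_ballSet_of_walk (p.takeUntil z hz) ((p.length_takeUntil_le_length hz).trans hp)
  refine (SimpleGraph.edist_le (p.induce _ hs)).trans ?_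
  have := congrArg SimpleGraph.Walk.length (SimpleGraph.Walk.map_induce p hs)
  rw [SimpleGraph.Walk.length_map] at this
  rw [this]
  exact_mod_cast hp

/-- A multigraph with a proper edge colouring, given by its half-edges: `k` is attached to the
vertex `base k`, its edge has colour `col k`, and `inv k` is the other half of that edge. Semi-edges
`inv k = k` are allowed. -/
structure HalfEdges (V K C : Type) where
  base : K → V
  inv : K → K
  col : K → C
  inv_inv : ∀ k, inv (inv k) = k
  col_inv : ∀ k, col (inv k) = col k
  col_inj : ∀ k k', base k = base k' → col k = col k' → k = k'

namespace HalfEdges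

open ReducedWord

variable {V K C : Type} (S : HalfEdges V K C) (m : ℕ)

/-- The end, in the covering, of the lift of the half-edge `k` that starts at height `g`. -/
noncomputable def next (k : K) (g : Equiv.Perm (ReducedWord C (m + 1))) :
    V × Equiv.Perm (ReducedWord C (m + 1)) :=
  (S.base (S.inv k), gen (m + 1) (S.col k) * g)

theorem next_inv_next (k : K) (g : Equiv.Perm (ReducedWord C (m + 1))) :
    S.next m (S.inv k) (S.next m k g).2 = (S.base k, g) := by
  simp only [next, S.inv_inv, S.col_inv, ← mul_assoc, gen_mul_self, one_mul]

/-- The covering of a multigraph on which crossing an edge of colour `c` multiplies the second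
coordinate by the involution `gen (m + 1) c`. -/
def cover : SimpleGraph (V × Equiv.Perm (ReducedWord C (m + 1))) where
  Adj a b := ∃ k, S.base k = a.1 ∧ b = S.next m k a.2
  symm := ⟨by
    rintro ⟨_, g⟩ _ ⟨k, rfl, rfl⟩
    exact ⟨S.inv k, rfl, (S.next_inv_next m k g).symm⟩⟩
  loopless := ⟨by
    rintro ⟨v, g⟩ ⟨k, -, h⟩
    exact gen_ne_one (S.col k) (mul_eq_right.1 (congrArg Prod.snd h).symm)⟩

theorem cover_adj {a b : V × Equiv.Perm (ReducedWord C (m + 1))} :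
    (S.cover m).Adj a b ↔ ∃ k, S.base k = a.1 ∧ b = S.next m k a.2 := Iff.rfl

theorem next_inj {k k' : K} {g : Equiv.Perm (ReducedWord C (m + 1))} (hb : S.base k = S.base k')
    (h : S.next m k g = S.next m k' g) : k = k' :=
  S.col_inj k k' hb (gen_injective (mul_right_cancel (congrArg Prod.snd h)))

theorem treeLike_cover {r : ℕ} (hr : r ≤ m) (x : V × Equiv.Perm (ReducedWord C (m + 1))) :
    TreeLike ((S.cover m).induce (ballSet (S.cover m) x r)) ⟨x, mem_ballSet_self _ x r⟩ := by
  classical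
  set B := (S.cover m).induce (ballSet (S.cover m) x r)
  have hadj : ∀ y z, B.Adj y z → ∃ k, S.base k = y.1.1 ∧ z.1 = S.next m k y.1.2 :=
    fun y z h => (S.cover_adj m).1 h
  let k₀ : (y z : ballSet (S.cover m) x r) → B.Adj y z → K := fun y z h => (hadj y z h).choose
  have hk₀ : ∀ y z h, S.base (k₀ y z h) = y.1.1 ∧ z.1 = S.next m (k₀ y z h) y.1.2 :=
    fun y z h => (hadj y z h).choose_spec
  -- the colour `c₀` is only a default value for pairs that are not joined by an edge
  by_cases hC : Nonempty C
  swap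
  · have : ∀ y z, ¬ B.Adj y z := fun y z h => hC ⟨S.col (k₀ y z h)⟩
    exact ⟨fun y z h => absurd h (this y z), fun y u u' h => absurd h (this u y)⟩
  obtain ⟨c₀⟩ := hC
  refine treeLike_of_gen (connected_induce_ballSet _ x r) (r := r) (m := m + 1) (fun y => ?_)
    (by omega) (fun y => y.1.2) (fun y z => if h : B.Adj y z then S.col (k₀ y z h) else c₀) ?_ ?_ ?_
  · exact ENat.toNat_le_of_le_natCast (dist_induce_ballSet_le _ x r y)
  · intro y z h
    rw [dif_pos h]
    exact congrArg Prod.snd (hk₀ y z h).2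
  · intro y z h
    rw [dif_pos h, dif_pos h.symm]
    have h1 := hk₀ y z h
    have h2 := hk₀ z y h.symm
    have h3 := congrArg Prod.snd h1.2
    have h4 := congrArg Prod.snd h2.2
    simp only [next] at h3 h4
    rw [h3, ← mul_assoc, right_eq_mul] at h4
    refine gen_injective (m := m) ?_
    rw [← mul_one (gen _ _), ← gen_mul_self (S.col (k₀ y z h)), ← mul_assoc, h4, one_mul]
  · intro y z z' h h' hc
    rw [dif_pos h, dif_pos h'] at hc
    have h1 := hk₀ y z h
    have h2 := hk₀ y z' h'
    have := S.col_inj _ _ (h1.1.trans h2.1.symm) hc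
    rw [← this] at h2
    exact Subtype.ext (h1.2.trans h2.2.symm)

variable [Fintype K] [DecidableEq V]

theorem degLE_cover {d : ℕ} (hd : ∀ v, (Finset.univ.filter fun k => S.base k = v).card ≤ d) :
    DegLE (S.cover m) d := by
  classical
  rintro ⟨v, g⟩
  have : (S.cover m).neighborSet (v, g) ⊆
      ((Finset.univ.filter fun k => S.base k = v).image fun k => S.next m k g : Finset _) := by
    rintro _ ⟨k, hk, rfl⟩
    simpa using ⟨k, hk, rfl⟩
  refine (Set.encard_le_encard this).trans ?_
  rw [Set.encard_coe_eq_coe_finsetCard]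
  exact_mod_cast Finset.card_image_le.trans (hd v)

theorem nbrs_cover {d : ℕ} (hd : DegLE (S.cover m) d) (v : V)
    (g : Equiv.Perm (ReducedWord C (m + 1))) :
    (nbrs (S.cover m) (v, g)).val =
      (Finset.univ.filter fun k => S.base k = v).val.map fun k => S.next m k g := by
  classical
  rw [← Finset.image_val_of_injOn]
  · congr 1
    ext b
    simp [mem_nbrs hd, cover_adj, eq_comm]
  · intro k hk k' hk' h
    simp only [Finset.coe_filter, Finset.mem_univ, true_and, Set.mem_ofPred_eq] at hk hk'
    exact S.next_inj m (hk.trans hk'.symm) h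

/-- If the half-edges at `v` are labelled with the elements of the shape `t v`, and the label of
every half-edge is the shape, cut off, of what its other end prescribes on the far side, then the
covering has the prescribed shapes. -/
theorem ballShape_cover {d R : ℕ} (hd : DegLE (S.cover m) d) (t : V → Multiset (Shape R))
    (a : K → Shape R)
    (ht : ∀ v, t v = (Finset.univ.filter fun k => S.base k = v).val.map a)
    (ha : ∀ k, a k = Shape.cut (R + 1) R (by
      classical exact (t (S.base (S.inv k))).erase (a (S.inv k))))
    (v : V) (g : Equiv.Perm (ReducedWord C (m + 1))) :
    ballShape (S.cover m) (R + 1) (v, g) = t v := by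
  classical
  have key : ∀ j ≤ R, ∀ k g, coneShape (S.cover m) j (S.next m k g) (S.base k, g) =
      Shape.cut R j (a k) := by
    intro j
    induction j with
    | zero => intro _ k g; rfl
    | succ j ih =>
      intro hj k g
      have hmem : S.inv k ∈ (Finset.univ.filter fun k' => S.base k' = S.base (S.inv k)).val := by
        simp
      rw [ha k, Shape.cut_cut hj (by omega), Shape.cut_succ, ht,
        ← Multiset.map_erase_of_mem _ _ hmem, Multiset.map_map, coneShape_succ, Finset.erase_val]
      rw [show S.next m k g = (S.base (S.inv k), (S.next m k g).2) from rfl, nbrs_cover S m hd,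
        ← S.next_inv_next m k g, ← Multiset.map_erase_of_mem _ _ hmem, Multiset.map_map,
        ← Finset.erase_val]
      refine Multiset.map_congr rfl fun k' hk' => ?_
      simp only [Finset.mem_val, Finset.mem_erase, Finset.mem_filter, Finset.mem_univ,
        true_and] at hk'
      simp only [Function.comp_apply]
      rw [← hk'.2]
      exact ih (by omega) k' _
  rw [ballShape_succ, nbrs_cover S m hd, Multiset.map_map, ht]
  refine Multiset.map_congr rfl fun k hk => ?_
  simp only [Finset.mem_val, Finset.mem_filter, Finset.mem_univ, true_and] at hk
  rw [Function.comp_apply, ← hk, key R le_rfl, Shape.cut_self]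

end HalfEdges

namespace HalfEdges

/-- The bipartite multigraph on two copies of `V` that joins each half-edge `h` in the first copy
with the half-edge `π h` in the second copy. All its edges have different colours. -/
def bipartite {V H : Type} (base : H → V) (π : H ≃ H) : HalfEdges (V × Bool) (H × Bool) H where
  base k := (base k.1, k.2)
  inv k := (if k.2 then π.symm k.1 else π k.1, !k.2)
  col k := if k.2 then π.symm k.1 else k.1
  inv_inv := by rintro ⟨h, _ | _⟩ <;> simp
  col_inv := by rintro ⟨h, _ | _⟩ <;> simp
  col_inj := by rintro ⟨h, _ | _⟩ ⟨h', _ | _⟩ <;> simp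

end HalfEdges

open Classical in
/-- In a tree whose shape to depth `R + 1` is `t`, the number of edges from the root `x` to a
vertex `y` such that the branch at `y` away from `x` has shape `a` and the branch at `x` away from
`y` has shape `b`, both to depth `R`. -/
noncomputable def edgeCount {R : ℕ} (t : Multiset (Shape R)) (a b : Shape R) : ℕ :=
  if Shape.cut (R + 1) R (t.erase a) = b then t.count a else 0

theorem sum_map_ite_eq_count {α : Type} [DecidableEq α] (m : Multiset α) (a : α) :
    (m.map fun x => if x = a then 1 else 0).sum = m.count a := by
  induction m using Multiset.induction_on with
  | empty => simp
  | cons x m ih =>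
    rw [Multiset.map_cons, Multiset.sum_cons, ih, Multiset.count_cons, add_comm]
    simp only [eq_comm]

open Classical in
theorem sum_map_ite_eq_edgeCount {R : ℕ} (t : Multiset (Shape R))
    (a b : Shape R) :
    (t.map fun x => if (x, Shape.cut (R + 1) R (t.erase x)) = (a, b) then 1 else 0).sum =
      edgeCount t a b := by
  rw [edgeCount]
  split_ifs with h
  · rw [← sum_map_ite_eq_count]
    refine congrArg _ (Multiset.map_congr rfl fun x _ => if_congr ?_ rfl rfl)
    rw [Prod.mk.injEq]
    refine and_iff_left_of_imp ?_
    rintro rfl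
    exact h
  · rw [Multiset.map_congr rfl (g := fun _ => 0), Multiset.map_const', Multiset.sum_replicate,
      smul_zero]
    intro x _
    refine if_neg fun h' => h ?_
    rw [Prod.mk.injEq] at h'
    obtain ⟨rfl, h'⟩ := h'
    exact h'

/-- The vertices, `n t` of them for every shape `t` in `F`, with the edges that they want to have,
can be matched to a finite graph without short cycles as soon as the numbers of edges wanted from
both sides are balanced. -/
theorem exists_finGraph_of_balanced {d R : ℕ} (F : Finset (Multiset (Shape R)))
    (hF : ∀ t ∈ F, t.card ≤ d) (n : F → ℕ)
    (hbal : ∀ a b, ∑ t, n t * edgeCount t.1 a b = ∑ t, n t * edgeCount t.1 b a) (r : ℕ) :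
    ∃ G : FinGraph d, (∀ s ≤ r, ∀ x, TreeLike (G.graph.induce (ballSet G.graph x s))
        ⟨x, mem_ballSet_self _ x s⟩) ∧
      (∀ x, (ballShape G.graph (R + 1) x : Multiset _) ∈ F) ∧
      ∃ M : ℕ, 0 < M ∧ Nat.card G.V = M * ∑ t, n t ∧
        ∀ t, {x | ballShape G.graph (R + 1) x = t.1}.ncard = M * n t := by
  classical
  -- a half-edge is a vertex with an element of its shape; its label is the type of its edge
  let V := Σ t : F, Fin (n t)
  let H := Σ v : V, Multiset.ToType (v.1 : Multiset (Shape R))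
  let lab : H → Shape R × Shape R := fun h =>
    (h.2.1, Shape.cut (R + 1) R (h.1.1.1.erase h.2.1))
  have hcard : ∀ a b, Fintype.card {h // lab h = (a, b)} = ∑ t, n t * edgeCount t.1 a b := by
    intro a b
    rw [Fintype.card_subtype, Finset.card_filter, Fintype.sum_sigma, Fintype.sum_sigma]
    refine Finset.sum_congr rfl fun t _ => ?_
    refine (Finset.sum_congr rfl fun j _ => ?_).trans
      ((Finset.sum_const (edgeCount t.1 a b)).trans (by rw [Finset.card_fin, smul_eq_mul]))
    rw [← sum_map_ite_eq_edgeCount, ← Multiset.map_univ]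
    rfl
  have hfib : ∀ c : Shape R × Shape R,
      Nonempty ({h // (lab h).swap = c} ≃ {h // lab h = c}) := by
    rintro ⟨a, b⟩
    rw [← Fintype.card_eq, hcard, hbal, ← hcard]
    refine Fintype.card_congr (Equiv.subtypeEquivRight fun h => ?_)
    rw [Prod.swap_eq_iff_eq_swap, Prod.swap_prod_mk]
  let e := fun c => (hfib c).some
  have hπ := Equiv.ofFiberEquiv_map e
  set π : H ≃ H := Equiv.ofFiberEquiv e
  have hπ' : ∀ h, (lab h).swap = lab (π h) := fun h => (hπ h).symm
  let S := HalfEdges.bipartite (fun h : H => h.1) π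
  let t : V × Bool → Multiset (Shape R) := fun v => v.1.1.1
  let a : H × Bool → Shape R := fun k => k.1.2.1
  have ht : ∀ v, t v = (Finset.univ.filter fun k => S.base k = v).val.map a := by
    rintro ⟨v, i⟩
    rw [show t (v, i) = _ from (Multiset.map_univ_coe _).symm]
    refine Multiset.map_eq_map_of_bij_of_nodup _ _ (Finset.nodup _) (Finset.nodup _)
      (fun x _ => (⟨v, x⟩, i)) ?_ ?_ ?_ ?_
    · intro x _
      simp [S, HalfEdges.bipartite]
    · intro x _ y _ h
      exact eq_of_heq (Sigma.mk.inj (congrArg Prod.fst h)).2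
    · rintro ⟨⟨w, x⟩, i'⟩ h
      simp only [Finset.mem_val, Finset.mem_filter, Finset.mem_univ, true_and, S,
        HalfEdges.bipartite, Prod.mk.injEq] at h
      obtain ⟨rfl, rfl⟩ := h
      exact ⟨x, Finset.mem_univ_val _, rfl⟩
    · intro x _
      rfl
  have ha : ∀ k, a k = Shape.cut (R + 1) R ((t (S.base (S.inv k))).erase (a (S.inv k))) := by
    rintro ⟨h, _ | _⟩
    · exact congrArg Prod.snd (hπ' h)
    · have := congrArg Prod.fst (hπ' (π.symm h))
      rw [Equiv.apply_symm_apply] at this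
      exact this.symm
  have hdeg : DegLE (S.cover r) d := by
    refine S.degLE_cover r fun v => ?_
    have := congrArg Multiset.card (ht v)
    rw [Multiset.card_map, Finset.card_val] at this
    rw [← this]
    exact hF _ v.1.1.2
  have hshape : ∀ x, ballShape (S.cover r) (R + 1) x = x.1.1.1.1 := fun x =>
    S.ballShape_cover r hdeg t a ht ha x.1 x.2
  refine ⟨⟨_, inferInstance, S.cover r, hdeg⟩, fun s hs x => S.treeLike_cover r hs x,
    fun x => by rw [hshape]; exact x.1.1.1.2,
    2 * Nat.card (Equiv.Perm (ReducedWord H (r + 1))), ?_, ?_, ?_⟩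
  · have := Nat.card_pos (α := Equiv.Perm (ReducedWord H (r + 1)))
    omega
  · rw [Nat.card_prod, Nat.card_prod, Nat.card_sigma]
    simp only [Nat.card_eq_fintype_card, Fintype.card_fin, Fintype.card_bool]
    ring
  · intro t
    let f : Fin (n t) × Bool × Equiv.Perm (ReducedWord H (r + 1)) →
      (V × Bool) × Equiv.Perm (ReducedWord H (r + 1)) := fun z => ((⟨t, z.1⟩, z.2.1), z.2.2)
    have hf : Function.Injective f := by
      rintro ⟨j, i, g⟩ ⟨j', i', g'⟩ h
      have h1 := congrArg Prod.fst (congrArg Prod.fst h)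
      exact Prod.ext (eq_of_heq (Sigma.mk.inj h1).2)
        (Prod.ext (congrArg (fun z => z.1.2) h) (congrArg (fun z => z.2) h))
    have hset : {x | ballShape (S.cover r) (R + 1) x = t.1} = Set.range f := by
      ext ⟨⟨⟨s, j⟩, i⟩, g⟩
      rw [Set.mem_ofPred_eq, hshape]
      constructor
      · intro h
        obtain rfl := Subtype.ext h
        exact ⟨(j, i, g), rfl⟩
      · rintro ⟨z, hz⟩
        rw [← hz]
    rw [hset, ← Nat.card_coe_set_eq, Nat.card_range_of_injective hf, Nat.card_prod, Nat.card_prod]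
    simp only [Nat.card_eq_fintype_card, Fintype.card_fin, Fintype.card_bool]
    ring

/-! ### Shapes and cylinder sets in the spaces of rooted graphs -/

theorem DegLE.iso {V W : Type} {G : SimpleGraph V} {H : SimpleGraph W} {d : ℕ} (h : DegLE G d)
    (f : G ≃g H) : DegLE H d := by
  intro w
  refine le_trans ?_ (h (f.symm w))
  rw [← f.symm.injective.encard_image]
  refine Set.encard_le_encard ?_
  rintro _ ⟨v, hv, rfl⟩
  exact f.symm.map_adj_iff.2 hv

theorem finite_ballSet {V : Type} {G : SimpleGraph V} {d : ℕ} (hG : DegLE G d) (x : V) (r : ℕ) :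
    (ballSet G x r).Finite := by
  induction r with
  | zero =>
    refine (Set.finite_singleton x).subset fun y hy => ?_
    obtain ⟨p, hp⟩ := mem_ballSet_iff.1 hy
    exact (SimpleGraph.Walk.eq_of_length_eq_zero (Nat.le_zero.1 hp)).symm
  | succ r ih =>
    have hfin : ∀ z, (G.neighborSet z).Finite := fun z => Set.finite_of_encard_le_coe (hG z)
    refine (ih.union (ih.biUnion fun z _ => hfin z)).subset fun y hy => ?_
    obtain ⟨p, hp⟩ := mem_ballSet_iff.1 hy
    by_cases hn : p.Nil
    · exact Or.inl (hn.eq ▸ mem_ballSet_self G x r)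
    · refine Or.inr (Set.mem_biUnion (mem_ballSet_of_walk p.dropLast ?_) (p.adj_penultimate hn))
      simp
      omega

namespace RootedGraph

variable {d : ℕ}

theorem isBall_ball (r : ℕ) (G : RootedGraph d) : (G.ball r).IsBall r :=
  fun y => dist_induce_ballSet_le G.graph G.root r y

theorem IsBall.finite {r : ℕ} {G : RootedGraph d} (h : G.IsBall r) : Finite G.V := by
  have : ballSet G.graph G.root r = Set.univ := Set.eq_univ_of_forall h
  exact Set.finite_univ_iff.1 (this ▸ finite_ballSet G.deg_le G.root r)

theorem IsBall.iso {r : ℕ} {G H : RootedGraph d} (h : G.IsBall r) (hGH : G.IsIso H) :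
    H.IsBall r := by
  obtain ⟨f, hf⟩ := hGH
  intro y
  have := (map_mem_ballSet f (x := G.root) (y := f.symm y) (r := r)).2 (h _)
  rwa [hf, f.apply_symm_apply] at this

end RootedGraph

namespace Grd

variable {d : ℕ}

/-- The shape, to depth `n`, of a rooted graph seen from its root. -/
noncomputable def shape (n : ℕ) : Grd d → Shape n :=
  Quotient.lift (fun G : RootedGraph d => ballShape G.graph n G.root) fun G H ⟨f, hf⟩ =>
    (ballShape_iso G.deg_le H.deg_le f n G.root).trans (congrArg _ hf)

theorem shape_mk (n : ℕ) (G : RootedGraph d) : shape n (mk G) = ballShape G.graph n G.root := rfl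

theorem shape_ball (r : ℕ) (G : Grd d) : shape r (ball r G) = shape r G := by
  induction G using Quotient.inductionOn with
  | _ G => exact ballShape_induce G.deg_le G.root r

theorem shape_mem_bounded (n : ℕ) (G : Grd d) : shape n G ∈ Shape.bounded d n := by
  induction G using Quotient.inductionOn with
  | _ G => exact ballShape_mem_bounded G.deg_le n G.root

theorem ball_mem_balls (r : ℕ) (G : Grd d) : ball r G ∈ balls d r := by
  induction G using Quotient.inductionOn with
  | _ G => exact ⟨G.ball r, G.isBall_ball r, rfl⟩

/-- A chosen representative of an isomorphism class. -/
noncomputable def rep (α : Grd d) : RootedGraph d := Quotient.out α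

theorem mk_rep (α : Grd d) : mk α.rep = α := Quotient.out_eq α

theorem isIso_rep (A : RootedGraph d) : A.IsIso (mk A).rep := Setoid.symm (Quotient.mk_out A)

theorem isBall_rep {r : ℕ} {α : Grd d} (h : α ∈ balls d r) : α.rep.IsBall r := by
  obtain ⟨A, hA, rfl⟩ := h
  exact hA.iso (isIso_rep A)

theorem measurableSet_cyl {r : ℕ} {α : Grd d} (h : α ∈ balls d r) : MeasurableSet (cyl r α) := by
  have : IsOpen (cyl r α) := TopologicalSpace.isOpen_generateFrom_of_mem ⟨r, α, h, rfl⟩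
  exact this.measurableSet

theorem countable_balls (d r : ℕ) : (balls d r).Countable := by
  let g : {p : Σ n, SimpleGraph (Fin n) × Fin n // p.2.1.Connected ∧ DegLE p.2.1 d} → Grd d :=
    fun p => mk ⟨Fin p.1.1, inferInstance, p.1.2.1, p.2.1, p.2.2, p.1.2.2⟩
  refine (Set.countable_range g).mono ?_
  rintro _ ⟨A, hA, rfl⟩
  have := hA.finite
  let e := Finite.equivFin A.V
  let f := SimpleGraph.Iso.map e A.graph
  exact ⟨⟨⟨_, A.graph.map e.toEmbedding, e A.root⟩, f.connected_iff.1 A.connected,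
    A.deg_le.iso f⟩, Quotient.sound ⟨f.symm, f.symm_apply_apply _⟩⟩

/-- A property that only depends on the `r`-ball defines a measurable set, and the measure of this
set is the sum of the measures of the cylinder sets of which it consists. -/
theorem measure_eq_tsum (μ : Measure (Grd d)) (r : ℕ) (S : Set (Grd d))
    (hS : ∀ G, ball r G ∈ S ↔ G ∈ S) :
    MeasurableSet S ∧ μ S = ∑' α : balls d r, S.indicator (fun α => μ (cyl r α)) α.1 := by
  have := (countable_balls d r).to_subtype
  have hU : S = ⋃ α : balls d r, {G | ball r G = α.1 ∧ α.1 ∈ S} := by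
    ext G
    rw [Set.mem_iUnion]
    constructor
    · exact fun h => ⟨⟨_, ball_mem_balls r G⟩, rfl, (hS G).2 h⟩
    · rintro ⟨α, h, hα⟩
      rw [← hS, h]
      exact hα
  have hpiece : ∀ α : balls d r, MeasurableSet {G | ball r G = α.1 ∧ α.1 ∈ S} ∧
      μ {G | ball r G = α.1 ∧ α.1 ∈ S} = S.indicator (fun α => μ (cyl r α)) α.1 := by
    intro α
    by_cases hα : α.1 ∈ S
    · have he : {G | ball r G = α.1 ∧ α.1 ∈ S} = cyl r α.1 := by
        ext G
        exact and_iff_left hα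
      rw [he, Set.indicator_of_mem hα]
      exact ⟨measurableSet_cyl α.2, rfl⟩
    · simp [hα]
  refine ⟨hU ▸ MeasurableSet.iUnion fun α => (hpiece α).1, ?_⟩
  conv_lhs => rw [hU]
  rw [measure_iUnion _ fun α => (hpiece α).1]
  · exact tsum_congr fun α => (hpiece α).2
  · rintro α β hne
    refine Set.disjoint_left.2 ?_
    rintro G ⟨h, -⟩ ⟨h', -⟩
    exact hne (Subtype.ext (h.symm.trans h'))

end Grd

namespace EdgeGrd

variable {d : ℕ}

/-- The shapes, to depth `n`, of the two branches at the ends of the distinguished edge: the one at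
the head, then the one at the root. -/
noncomputable def edgeShape (n : ℕ) : EdgeGrd d → Shape n × Shape n :=
  Quotient.lift (fun G : EdgeRootedGraph d =>
    (coneShape G.graph n G.head G.root, coneShape G.graph n G.root G.head)) fun G H ⟨f, hf, hf'⟩ =>
      Prod.ext ((coneShape_iso G.deg_le H.deg_le f n _ _).trans (by rw [hf, hf']))
        ((coneShape_iso G.deg_le H.deg_le f n _ _).trans (by rw [hf, hf']))

theorem edgeShape_flip (n : ℕ) (G : EdgeGrd d) : edgeShape n (flip G) = (edgeShape n G).swap := by
  induction G using Quotient.inductionOn with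
  | _ G => rfl

theorem edgeShape_ball (n : ℕ) (G : EdgeGrd d) :
    edgeShape n (ball (n + 1) (by omega) G) = edgeShape n G := by
  induction G using Quotient.inductionOn with
  | _ G =>
    have hh : G.head ∈ ballSet G.graph G.root 1 := G.head_mem_ballSet le_rfl
    exact Prod.ext
      (coneShape_induce G.deg_le G.root (n + 1) n 1 (by omega)
        ⟨G.head, G.head_mem_ballSet (by omega)⟩ ⟨G.root, mem_ballSet_self _ _ _⟩ hh)
      (coneShape_induce G.deg_le G.root (n + 1) n 0 (by omega)
        ⟨G.root, mem_ballSet_self _ _ _⟩ ⟨G.head, G.head_mem_ballSet (by omega)⟩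
        (mem_ballSet_self _ _ _))

/-- The rooted graph without the distinguished edge. -/
def forget : EdgeGrd d → Grd d :=
  Quotient.map EdgeRootedGraph.toRootedGraph fun _ _ ⟨f, hf, _⟩ => ⟨f, hf⟩

theorem forget_ball (r : ℕ) (hr : 1 ≤ r) (G : EdgeGrd d) :
    forget (ball r hr G) = Grd.ball r (forget G) := by
  induction G using Quotient.inductionOn with
  | _ G => rfl

/-- The pairs of a rooted `r`-ball, represented by a fixed graph, and a neighbour of its root. -/
abbrev BallEdge (d r : ℕ) : Type 1 :=
  Σ α : Grd.balls d r, {y // α.1.rep.graph.Adj α.1.rep.root y}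

instance (r : ℕ) : Countable (BallEdge d r) := by
  have := (Grd.countable_balls d r).to_subtype
  have : ∀ α : Grd.balls d r, Countable α.1.rep.V :=
    fun α => α.1.rep.countable
  unfold BallEdge
  infer_instance

/-- The fixed representative of a ball, with the given distinguished edge. -/
noncomputable def BallEdge.graph {r : ℕ} (i : BallEdge d r) : EdgeRootedGraph d where
  toRootedGraph := i.1.1.rep
  head := i.2
  adj := i.2.2

/-- The isomorphism class of a ball with a distinguished edge. -/
noncomputable def BallEdge.cls {r : ℕ} (i : BallEdge d r) : EdgeGrd d := mk i.graph

theorem BallEdge.forget_cls {r : ℕ} (i : BallEdge d r) : forget i.cls = i.1.1 :=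
  Grd.mk_rep i.1.1

theorem exists_cls_eq_ball (r : ℕ) (hr : 1 ≤ r) (G : EdgeGrd d) :
    ∃ i : BallEdge d r, i.cls = ball r hr G := by
  have hα : forget (ball r hr G) ∈ Grd.balls d r := forget_ball r hr G ▸ Grd.ball_mem_balls r _
  generalize ball r hr G = B at hα
  induction B using Quotient.inductionOn with
  | _ A =>
    obtain ⟨f, hf⟩ : A.toRootedGraph.IsIso (Grd.rep (forget (mk A))) :=
      Grd.isIso_rep A.toRootedGraph
    refine ⟨⟨⟨_, hα⟩, f A.head, ?_⟩, Quotient.sound ⟨f.symm, ?_, f.symm_apply_apply _⟩⟩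
    · have := f.map_adj_iff.2 A.adj
      rwa [hf] at this
    · exact (congrArg f.symm hf.symm).trans (f.symm_apply_apply _)

theorem measurableSet_cyl {r : ℕ} (hr : 1 ≤ r) (i : BallEdge d r) :
    MeasurableSet (cyl r hr i.cls) := by
  have : IsOpen (cyl r hr i.cls) := TopologicalSpace.isOpen_generateFrom_of_mem
    ⟨r, hr, i.graph, Grd.isBall_rep i.1.2, rfl⟩
  exact this.measurableSet

/-- The number of neighbours of the root that give the same distinguished edge up to isomorphism
is the multiplicity of this edge. -/
theorem card_cls_eq {r : ℕ} (i : BallEdge d r) :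
    ENat.card {j : BallEdge d r // j.cls = i.cls} = i.graph.multiplicity := by
  obtain ⟨α, y, hy⟩ := i
  let A : RootedGraph d := α.1.rep
  let T : Set A.V := {z | A.graph.Adj A.root z ∧
    ∃ f : A.graph ≃g A.graph, f A.root = A.root ∧ f y = z}
  let F : T → {j : BallEdge d r // j.cls = BallEdge.cls ⟨α, y, hy⟩} := fun z =>
    ⟨⟨α, z.1, z.2.1⟩, by
      obtain ⟨f, hf, hf'⟩ := z.2.2
      exact Quotient.sound (Setoid.symm ⟨f, hf, hf'⟩)⟩
  have hF : Function.Bijective F := by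
    constructor
    · rintro ⟨z, hz⟩ ⟨w, hw⟩ h
      have h1 : (⟨z, hz.1⟩ : {y // α.1.rep.graph.Adj α.1.rep.root y}) = ⟨w, hw.1⟩ :=
        eq_of_heq (Sigma.mk.inj (congrArg Subtype.val h)).2
      exact Subtype.ext (Subtype.mk.inj h1)
    · rintro ⟨⟨β, z, hz⟩, h⟩
      obtain rfl : β = α := by
        exact Subtype.ext ((BallEdge.forget_cls ⟨β, z, hz⟩).symm.trans
          ((congrArg forget h).trans (BallEdge.forget_cls ⟨α, y, hy⟩)))
      obtain ⟨f, hf, hf'⟩ : EdgeRootedGraph.IsIso _ _ := Quotient.exact h.symm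
      exact ⟨⟨z, hz, f, hf, hf'⟩, rfl⟩
  rw [← ENat.card_congr (Equiv.ofBijective F hF)]
  have : Finite A.V := (Grd.isBall_rep α.2).finite
  rw [ENat.card_eq_coe_natCard]
  rfl

/-- The measure induced on the space of graphs with a distinguished edge, of a set that is
determined by the `r`-ball: choose a ball at random and sum over the edges at its root. -/
theorem measure_eq_tsum {μ : Measure (Grd d)} {ν : Measure (EdgeGrd d)}
    (h : IsInducedEdgeMeasure μ ν) (r : ℕ) (hr : 1 ≤ r) (S : Set (EdgeGrd d))
    (hS : ∀ G, ball r hr G ∈ S ↔ G ∈ S) :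
    MeasurableSet S ∧
      ν S = ∑' i : BallEdge d r, S.indicator (fun _ => μ (Grd.cyl r i.1.1)) i.cls := by
  let c : BallEdge d r → Set.range (BallEdge.cls (d := d) (r := r)) := Set.rangeFactorization _
  have hU : S = ⋃ A : Set.range (BallEdge.cls (d := d) (r := r)),
      {G | ball r hr G = A.1 ∧ A.1 ∈ S} := by
    ext G
    rw [Set.mem_iUnion]
    constructor
    · exact fun h => ⟨⟨_, exists_cls_eq_ball r hr G⟩, rfl, (hS G).2 h⟩
    · rintro ⟨A, h, hA⟩
      rw [← hS, h]
      exact hA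
  have hpiece : ∀ i : BallEdge d r, MeasurableSet {G | ball r hr G = i.cls ∧ i.cls ∈ S} ∧
      ν {G | ball r hr G = i.cls ∧ i.cls ∈ S} =
        S.indicator (fun _ => i.graph.multiplicity * μ (Grd.cyl r i.1.1)) i.cls := by
    intro i
    by_cases hi : i.cls ∈ S
    · have := h r hr i.graph (Grd.isBall_rep i.1.2)
      rw [show Grd.mk i.graph.toRootedGraph = i.1.1 from Grd.mk_rep i.1.1] at this
      have he : {G | ball r hr G = i.cls ∧ i.cls ∈ S} = cyl r hr i.cls := by
        ext G
        exact and_iff_left hi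
      rw [he, Set.indicator_of_mem hi]
      exact ⟨measurableSet_cyl hr i, this⟩
    · simp [hi]
  have hmeas : ∀ A : Set.range (BallEdge.cls (d := d) (r := r)),
      MeasurableSet {G | ball r hr G = A.1 ∧ A.1 ∈ S} := by
    rintro ⟨_, i, rfl⟩
    exact (hpiece i).1
  have : Countable (Set.range (BallEdge.cls (d := d) (r := r))) :=
    (Set.countable_range _).to_subtype
  refine ⟨hU ▸ MeasurableSet.iUnion hmeas, ?_⟩
  conv_lhs => rw [hU]
  rw [measure_iUnion _ hmeas, ← (Equiv.sigmaFiberEquiv c).tsum_eq, ENNReal.tsum_sigma']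
  · refine tsum_congr ?_
    rintro ⟨_, i, rfl⟩
    rw [(hpiece i).2]
    have hc : ∀ j : BallEdge d r, c j = ⟨i.cls, i, rfl⟩ ↔ j.cls = i.cls := fun j => Subtype.ext_iff
    have hterm : ∀ j : {j // c j = ⟨i.cls, i, rfl⟩},
        S.indicator (fun _ => μ (Grd.cyl r j.1.1.1)) j.1.cls =
          S.indicator (fun _ => μ (Grd.cyl r i.1.1)) i.cls := by
      rintro ⟨j, hj⟩
      rw [hc] at hj
      simp only
      rw [← BallEdge.forget_cls, hj, BallEdge.forget_cls]
    refine Eq.trans ?_ (tsum_congr hterm).symm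
    rw [ENNReal.tsum_const, ENat.card_congr (Equiv.subtypeEquivRight hc), card_cls_eq]
    by_cases hi : i.cls ∈ S <;> simp [hi]
  · rintro A B hne
    refine Set.disjoint_left.2 ?_
    rintro G ⟨h, -⟩ ⟨h', -⟩
    exact hne (Subtype.ext (h.symm.trans h'))

end EdgeGrd

/-! ### Involution invariance as a balance of edge shapes -/

section Balance

open Classical in
theorem tsum_ite_coneShape {V : Type} {G : SimpleGraph V} {d : ℕ} (hG : DegLE G d) (R : ℕ) (x : V)
    (a b : Shape R) (c : ENNReal) :
    ∑' y : {y // G.Adj x y},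
      (if (coneShape G R y x, coneShape G R x y) = (a, b) then c else 0) =
      edgeCount (ballShape G (R + 1) x) a b * c := by
  rw [← (Equiv.subtypeEquivRight fun y => mem_nbrs hG (x := x) (y := y)).tsum_eq, tsum_fintype]
  simp only [Equiv.subtypeEquivRight_apply_coe]
  rw [Finset.sum_coe_sort (nbrs G x)
      fun y => if (coneShape G R y x, coneShape G R x y) = (a, b) then c else 0,
    ← sum_map_ite_eq_edgeCount]
  have h : ((ballShape G (R + 1) x : Multiset (Shape R)).map fun z =>
      if (z, Shape.cut (R + 1) R ((ballShape G (R + 1) x).erase z)) = (a, b) then 1 else 0).sum =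
      ∑ y ∈ nbrs G x, if (coneShape G R y x, coneShape G R x y) = (a, b) then 1 else 0 := by
    conv_lhs => enter [1, 2]; rw [ballShape_succ]
    rw [Multiset.map_map]
    refine Finset.sum_congr rfl fun y hy => ?_
    rw [Function.comp_apply, ballShape_erase hG R ((mem_nbrs hG).1 hy),
      cut_coneShape G (by omega)]
  rw [h, Nat.cast_sum, Finset.sum_mul]
  refine Finset.sum_congr rfl fun y _ => ?_
  split_ifs <;> simp

variable {d : ℕ}

theorem measure_edgeShape_eq {μ : Measure (Grd d)} {ν : Measure (EdgeGrd d)}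
    (h : IsInducedEdgeMeasure μ ν) {R : ℕ} (F : Finset (Multiset (Shape R)))
    (hF : ∀ G : Grd d, (Grd.shape (R + 1) G : Multiset _) ∈ F) (a b : Shape R) :
    MeasurableSet {e : EdgeGrd d | EdgeGrd.edgeShape R e = (a, b)} ∧
      ν {e | EdgeGrd.edgeShape R e = (a, b)} =
        ∑ t : F, edgeCount t.1 a b * μ {G | Grd.shape (R + 1) G = t.1} := by
  classical
  obtain ⟨h1, h2⟩ := EdgeGrd.measure_eq_tsum h (R + 1) (by omega)
    {e | EdgeGrd.edgeShape R e = (a, b)} fun e => by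
      rw [Set.mem_ofPred_eq, EdgeGrd.edgeShape_ball]
      rfl
  refine ⟨h1, ?_⟩
  have hμ : ∀ t : F, μ {G | Grd.shape (R + 1) G = t.1} = ∑' α : Grd.balls d (R + 1),
      {G | Grd.shape (R + 1) G = t.1}.indicator (fun α => μ (Grd.cyl (R + 1) α)) α.1 := fun t =>
    (Grd.measure_eq_tsum μ (R + 1) _ fun G => by
      rw [Set.mem_ofPred_eq, Grd.shape_ball]
      rfl).2
  rw [h2, ENNReal.tsum_sigma']
  simp_rw [hμ, ← ENNReal.tsum_mul_left]
  rw [← Summable.tsum_finsetSum fun _ _ => ENNReal.summable]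
  refine tsum_congr fun α => ?_
  have hα := congrArg (Grd.shape (R + 1)) (Grd.mk_rep α.1)
  rw [Grd.shape_mk] at hα
  rw [Finset.sum_eq_single ⟨Grd.shape (R + 1) α.1, hF _⟩]
  · rw [Set.indicator_of_mem (by rfl)]
    change _ = (edgeCount (Grd.shape (R + 1) α.1) a b : ENNReal) * _
    rw [← hα, ← tsum_ite_coneShape α.1.rep.deg_le R α.1.rep.root a b]
    refine tsum_congr fun y => ?_
    rw [Set.indicator_apply]
    exact if_congr Iff.rfl rfl rfl
  · intro t _ ht
    rw [Set.indicator_of_notMem, mul_zero]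
    exact fun h => ht (Subtype.ext h.symm)
  · exact fun h => absurd (Finset.mem_univ _) h

/-- The mass transport principle for edge shapes: on average, a vertex has as many edges of shape
`(a, b)` as of the reversed shape `(b, a)`. -/
theorem sum_edgeCount_comm {μ : Measure (Grd d)} (h : IsInvolutionInvariant μ) {R : ℕ}
    (F : Finset (Multiset (Shape R)))
    (hF : ∀ G : Grd d, (Grd.shape (R + 1) G : Multiset _) ∈ F) (a b : Shape R) :
    ∑ t : F, edgeCount t.1 a b * μ {G | Grd.shape (R + 1) G = t.1} =
      ∑ t : F, edgeCount t.1 b a * μ {G | Grd.shape (R + 1) G = t.1} := by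
  obtain ⟨ν, hν, hflip⟩ := h
  rw [← (measure_edgeShape_eq hν F hF a b).2, ← (measure_edgeShape_eq hν F hF b a).2,
    ← hflip.measure_preimage (measure_edgeShape_eq hν F hF b a).1.nullMeasurableSet]
  congr 1
  ext e
  change _ ↔ EdgeGrd.edgeShape R (EdgeGrd.flip e) = (b, a)
  rw [EdgeGrd.edgeShape_flip, Prod.swap_eq_iff_eq_swap]
  rfl

end Balance

/-! ### Finite graphs approximating the measure -/

section Approximation

variable {d : ℕ}

theorem measurableSet_shape (n : ℕ) (P : Set (Shape n)) :
    MeasurableSet {G : Grd d | Grd.shape n G ∈ P} :=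
  (Grd.measure_eq_tsum 0 n _ fun G => by
    rw [Set.mem_ofPred_eq, Grd.shape_ball]
    rfl).1

/-- There are arbitrarily large finite graphs without short cycles in which the proportions of all
shapes are as close as desired to their probabilities. -/
theorem exists_finGraph_approx (μ : Measure (Grd d)) [IsProbabilityMeasure μ]
    (hinv : IsInvolutionInvariant μ) (R : ℕ) {ε : ℝ} (hε : 0 < ε) (K r : ℕ) :
    ∃ G : FinGraph d, K ≤ Nat.card G.V ∧
      (∀ s ≤ r, ∀ x, TreeLike (G.graph.induce (ballSet G.graph x s))
        ⟨x, mem_ballSet_self _ x s⟩) ∧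
      ∀ P : Set (Shape (R + 1)),
        |({x | ballShape G.graph (R + 1) x ∈ P}.ncard : ℝ) / Nat.card G.V -
          μ.real {G | Grd.shape (R + 1) G ∈ P}| < ε := by
  classical
  let F : Finset (Multiset (Shape R)) := (Shape.finite_bounded d (R + 1)).toFinset
  have hF : ∀ G : Grd d, (Grd.shape (R + 1) G : Multiset _) ∈ F := fun G => by
    rw [Set.Finite.mem_toFinset]
    exact Grd.shape_mem_bounded (R + 1) G
  let p : F → ℝ := fun t => μ.real {G | Grd.shape (R + 1) G = t.1}
  have hP : ∀ P : Set (Shape (R + 1)), μ.real {G | Grd.shape (R + 1) G ∈ P} =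
      ∑ t : F with t.1 ∈ P, p t := by
    intro P
    rw [← measureReal_biUnion_finset]
    · congr 1
      ext G
      simp only [Set.mem_ofPred_eq, Finset.mem_filter, Finset.mem_univ, true_and, Set.mem_iUnion]
      constructor
      · exact fun h => ⟨⟨_, hF G⟩, h, rfl⟩
      · rintro ⟨t, ht, h⟩
        rwa [h]
    · intro t _ s _ hts
      refine Set.disjoint_left.2 fun G h h' => hts (Subtype.ext (h.symm.trans h'))
    · exact fun t _ => measurableSet_shape (R + 1) {t.1}
  have hsum : ∑ t, p t = 1 := by
    have := hP Set.univ
    simpa using this.symm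
  obtain ⟨n, hK, hpos, hlin, happ⟩ := exists_nat_weights p (fun _ => measureReal_nonneg) hsum
    (ε := ε / (F.card + 1)) (by positivity) K
  have hbal : ∀ a b, ∑ t, n t * edgeCount t.1 a b = ∑ t, n t * edgeCount t.1 b a := by
    intro a b
    have h1 := congrArg ENNReal.toReal (sum_edgeCount_comm hinv F hF a b)
    rw [ENNReal.toReal_sum fun t _ => ENNReal.mul_ne_top (by simp) (measure_ne_top _ _),
      ENNReal.toReal_sum fun t _ => ENNReal.mul_ne_top (by simp) (measure_ne_top _ _)] at h1
    simp only [ENNReal.toReal_mul, ENNReal.toReal_natCast] at h1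
    have h2 := hlin (fun t => (edgeCount t.1 a b : ℤ) - edgeCount t.1 b a) (by
      push_cast
      simp only [sub_mul, Finset.sum_sub_distrib]
      exact sub_eq_zero.2 h1)
    simp only [sub_mul, Finset.sum_sub_distrib, sub_eq_zero] at h2
    have h3 : ∑ t, edgeCount t.1 a b * n t = ∑ t, edgeCount t.1 b a * n t := by exact_mod_cast h2
    simpa only [mul_comm] using h3
  obtain ⟨G, htree, hGF, M, hM, hcard, hfib⟩ := exists_finGraph_of_balanced F
    (fun t ht => ((Set.Finite.mem_toFinset _).1 ht).1) n hbal r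
  refine ⟨G, ?_, htree, fun P => ?_⟩
  · rw [hcard]
    nlinarith
  have hcount : {x | ballShape G.graph (R + 1) x ∈ P}.ncard = ∑ t : F with t.1 ∈ P, M * n t := by
    have := G.finite
    have := Fintype.ofFinite G.V
    rw [Set.ncard_eq_toFinset_card', Finset.card_eq_sum_card_fiberwise
      (f := fun x => (⟨ballShape G.graph (R + 1) x, hGF x⟩ : F))
      (t := Finset.univ.filter fun t : F => t.1 ∈ P)]
    · refine Finset.sum_congr rfl fun t ht => ?_
      rw [← hfib, Set.ncard_eq_toFinset_card']
      congr 1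
      ext x
      simp only [Finset.mem_filter, Finset.mem_univ, true_and] at ht
      simp only [Finset.mem_filter, Set.mem_toFinset, Set.mem_ofPred_eq, Subtype.ext_iff]
      exact ⟨And.right, fun h => ⟨h ▸ ht, h⟩⟩
    · intro x hx
      simpa using hx
  have hN : (0 : ℝ) < (∑ t, n t : ℕ) := by exact_mod_cast hpos
  have hM' : (0 : ℝ) < M := by exact_mod_cast hM
  have hquot : ((∑ t : F with t.1 ∈ P, M * n t : ℕ) : ℝ) / (M * ∑ t, n t : ℕ) =
      ∑ t : F with t.1 ∈ P, (n t : ℝ) / (∑ t, n t : ℕ) := by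
    rw [← Finset.mul_sum, Nat.cast_mul, Nat.cast_mul, mul_div_mul_left _ _ hM'.ne',
      Nat.cast_sum (Finset.univ.filter _), Finset.sum_div]
  rw [hcount, hcard, hquot, hP, ← Finset.sum_sub_distrib]
  calc |∑ t : F with t.1 ∈ P, ((n t : ℝ) / (∑ t, n t : ℕ) - p t)|
      ≤ ∑ t : F with t.1 ∈ P, |(n t : ℝ) / (∑ t, n t : ℕ) - p t| := Finset.abs_sum_le_sum_abs _ _
    _ ≤ ∑ t : F with t.1 ∈ P, ε / (F.card + 1) := Finset.sum_le_sum fun t _ => (happ t).le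
    _ = (Finset.univ.filter fun t : F => t.1 ∈ P).card * (ε / (F.card + 1)) := by
        rw [Finset.sum_const, nsmul_eq_mul]
    _ ≤ F.card * (ε / (F.card + 1)) := by
        gcongr
        exact (Finset.card_filter_le _ _).trans (by simp)
    _ < ε := by
        rw [mul_div_assoc', div_lt_iff₀ (by positivity)]
        nlinarith

theorem mk_eq_of_shape_eq {r : ℕ} {A B : RootedGraph d} (hA : A.IsBall r) (hB : B.IsBall r)
    (hAt : TreeLike A.graph A.root) (hBt : TreeLike B.graph B.root)
    (h : ballShape A.graph r A.root = ballShape B.graph r B.root) : Grd.mk A = Grd.mk B :=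
  Quotient.sound (exists_iso_of_shape_eq A.deg_le B.deg_le A.connected B.connected hAt hBt
    (fun v => ENat.toNat_le_of_le_natCast (hA v)) (fun v => ENat.toNat_le_of_le_natCast (hB v)) h)

theorem treeLike_of_mk_eq {A B : RootedGraph d} (h : Grd.mk A = Grd.mk B)
    (hA : TreeLike A.graph A.root) : TreeLike B.graph B.root := by
  obtain ⟨f, hf⟩ : A.IsIso B := Quotient.exact h
  exact hf ▸ hA.iso f

theorem FinGraph.isBall_ballAt {r : ℕ} (G : FinGraph d) (x : G.V) :
    haveI := G.finite
    (RootedGraph.ballAt G.graph G.deg_le x r).IsBall r :=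
  fun y => dist_induce_ballSet_le G.graph x r y

theorem treeLike_ball_of_isTree {G : RootedGraph d} (h : G.graph.IsTree) (r : ℕ) :
    TreeLike (G.ball r).graph (G.ball r).root :=
  treeLike_of_isTree ⟨(G.ball r).connected, h.isAcyclic.induce _⟩ _

theorem exists_isLocalLimit (μ : Measure (Grd d)) [IsProbabilityMeasure μ]
    (hinv : IsInvolutionInvariant μ) (htree : ∀ᵐ G ∂μ, Grd.IsTree G) :
    ∃ G : ℕ → FinGraph d, WeaklyConvergent G ∧ IsLocalLimit G μ := by
  choose G hcard hGt happ using fun n : ℕ =>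
    exists_finGraph_approx μ hinv n (ε := 1 / ((n : ℝ) + 1)) (by positivity) n (n + 1)
  have hlim : IsLocalLimit G μ := by
    intro r α hα
    have hbound : ∀ n, r ≤ n + 1 →
        |(G n).freq r α - (μ (Grd.cyl r α)).toReal| < 1 / ((n : ℝ) + 1) := by
      intro n hn
      have := (G n).finite
      obtain ⟨A, hA, rfl⟩ := hα
      by_cases hAt : TreeLike A.graph A.root
      · have hfreq : {x | (G n).ballClass r x = Grd.mk A} = {x | ballShape (G n).graph (n + 1) x ∈
            {t | Shape.cut (n + 1) r t = ballShape A.graph r A.root}} := by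
          ext x
          change _ ↔ Shape.cut (n + 1) r (ballShape (G n).graph (n + 1) x) = _
          rw [cut_ballShape _ hn, ← ballShape_induce (G n).deg_le x r]
          exact ⟨fun h => congrArg (Grd.shape r) h, fun h =>
            mk_eq_of_shape_eq ((G n).isBall_ballAt x) hA (hGt n r hn x) hAt h⟩
        have hcyl : μ (Grd.cyl r (Grd.mk A)) = μ {G | Grd.shape (n + 1) G ∈
            {t | Shape.cut (n + 1) r t = ballShape A.graph r A.root}} := by
          refine measure_congr ?_
          filter_upwards [htree] with H hH
          refine propext ?_
          change Grd.ball r H = _ ↔ Shape.cut (n + 1) r (Grd.shape (n + 1) H) = _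
          induction H using Quotient.inductionOn with
          | _ H =>
            have hcut : Shape.cut (n + 1) r (Grd.shape (n + 1) (Grd.mk H)) =
                Grd.shape r (Grd.ball r (Grd.mk H)) := by
              rw [Grd.shape_ball]
              exact cut_ballShape _ hn _
            refine Iff.trans ?_ (Eq.congr_left hcut).symm
            exact ⟨fun h => congrArg (Grd.shape r) h, fun h =>
              mk_eq_of_shape_eq (H.isBall_ball r) hA (treeLike_ball_of_isTree hH r) hAt h⟩
        rw [FinGraph.freq, hfreq, hcyl]
        exact happ n _
      · -- neither the finite graphs nor the random tree have balls that are not trees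
        have hfreq : {x | (G n).ballClass r x = Grd.mk A} = ∅ :=
          Set.eq_empty_of_forall_notMem fun x h => hAt (treeLike_of_mk_eq h (hGt n r hn x))
        have hcyl : μ (Grd.cyl r (Grd.mk A)) = 0 := by
          refine measure_mono_null (t := {H | ¬ Grd.IsTree H}) ?_ (ae_iff.1 htree)
          intro H hH hT
          induction H using Quotient.inductionOn with
          | _ H => exact hAt (treeLike_of_mk_eq hH (treeLike_ball_of_isTree hT r))
        rw [FinGraph.freq, hfreq, hcyl]
        simp only [Set.ncard_empty, Nat.cast_zero, zero_div, ENNReal.toReal_zero, sub_zero,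
          abs_zero]
        positivity
    rw [tendsto_iff_dist_tendsto_zero]
    refine squeeze_zero' (Eventually.of_forall fun _ => dist_nonneg) ?_
      tendsto_one_div_add_atTop_nhds_zero_nat
    filter_upwards [eventually_ge_atTop r] with n hn
    exact (hbound n (by omega)).le
  exact ⟨G, ⟨tendsto_atTop_mono hcard tendsto_id, fun r α hα => ⟨_, hlim r α hα⟩⟩, hlim⟩

end Approximation

end LocalLimit

theorem theorem1 (d : ℕ) (hd : 2 ≤ d)
    (μ : MeasureTheory.Measure (LocalLimit.Grd d)) [MeasureTheory.IsProbabilityMeasure μ]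
    (hinv : LocalLimit.IsInvolutionInvariant μ)
    (htree : ∀ᵐ G ∂μ, LocalLimit.Grd.IsTree G) :
    ∃ G : ℕ → LocalLimit.FinGraph d,
      LocalLimit.WeaklyConvergent G ∧ LocalLimit.IsLocalLimit G μ := by
  exact LocalLimit.exists_isLocalLimit μ hinv htree
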